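/- Let $n\ge 1$, let $Q=(q_{j,j'})$ be a symmetric nonnegative definite real $n\times n$ matrix with $q_{j,j}=1$ for all $j$ (so that $q_{j,j'}\in[-1,1]$), and let $\Delta_0$ be any symmetric nonnegative definite real $n\times n$ matrix. For $N\ge 1$ let $S_N\subset\mathbb{R}^N$ be the sphere of radius $\sqrt N$ centred at the origin, let $\lambda_N$ be the uniform probability measure on $S_N$, and for $\varepsilon>0$ let $$Q_\varepsilon=\Big\{(\sigma^1,\dots,\sigma^n)\in S_N^n:\ \tfrac1N(\sigma^j,\sigma^{j'})\in[q_{j,j'}-\varepsilon,\,q_{j,j'}+\varepsilon]\ \text{ for all } j,j'\le n\Big\}.$$ Let $(z_i^1,\dots,z_i^n)$, $i\le N$, be independent centred Gaussian vectors in $\mathbb{R}^n$ with covariance matrix $\Delta_0$, and let $\mathbf z^j=(z_1^j,\dots,z_N^j)\in\mathbb{R}^N$ for $j\le n$. Then for every $\varepsilon>0$ the set $Q_\varepsilon$ has positive $\lambda_N^n$-measure and the logarithm below is integrable for all sufficiently large $N$, the limit over $N\to\infty$ below exists and is finite, and $$\lim_{\varepsilon\downarrow0}\ \lim_{N\to\infty}\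 \frac1N\,\mathbb{E}\log\int_{Q_\varepsilon}\exp\Big(\sum_{j\le n}(\sigma^j,\mathbf z^j)\Big)\,d\lambda_N^n(\sigma^1,\dots,\sigma^n) =\inf_A\ \frac12\Big(\mathrm{Tr}(AQ)+\mathrm{Tr}(A^{-1}\Delta_0)-n-\log|A|\Big),$$ where the infimum is over all symmetric positive definite real $n\times n$ matrices $A$, $|A|$ denotes the determinant of $A$, and the outer limit and the infimum are taken in $[-\infty,\infty]$ (both are $-\infty$ when $Q$ is singular). -/

import Mathlib

open MeasureTheory ProbabilityTheory Filter Topology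

noncomputable section

namespace SphericalModel

/-- The uniform probability measure `λ_N` on the sphere `S_N` of radius `√N` centred at the origin
of `ℝ^N`, as a measure on `ℝ^N`: the normalized surface measure of the unit sphere, scaled by `√N`
(for `N = 0` the unit sphere is empty and this is the zero measure). -/
def sphereUniform (N : ℕ) : Measure (EuclideanSpace ℝ (Fin N)) :=
  let ω := (volume : Measure (EuclideanSpace ℝ (Fin N))).toSphere
  ((ω Set.univ)⁻¹ • ω).map
    (fun x : Metric.sphere (0 : EuclideanSpace ℝ (Fin N)) 1 =>
      √(N : ℝ) • (x : EuclideanSpace ℝ (Fin N)))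

/-- The overlap `R(σ, ρ) = N⁻¹ ∑_{i ≤ N} σ_i ρ_i`. -/
def overlap {N : ℕ} (σ ρ : EuclideanSpace ℝ (Fin N)) : ℝ :=
  inner ℝ σ ρ / (N : ℝ)

/-- The set `Q_ε` of `n`-tuples of points of the sphere `S_N` of radius `√N` whose overlaps are all
within `ε` of the entries of the matrix `Q`. -/
def overlapSet {n : ℕ} (N : ℕ) (Q : Matrix (Fin n) (Fin n) ℝ) (ε : ℝ) :
    Set (Fin n → EuclideanSpace ℝ (Fin N)) :=
  {σ | (∀ j, σ j ∈ Metric.sphere (0 : EuclideanSpace ℝ (Fin N)) (√(N : ℝ))) ∧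
    ∀ j j', overlap (σ j) (σ j') ∈ Set.Icc (Q j j' - ε) (Q j j' + ε)}

/-- The product measure `λ_N^n`. -/
def productUniform (n N : ℕ) : Measure (Fin n → EuclideanSpace ℝ (Fin N)) :=
  Measure.pi fun _ : Fin n => sphereUniform N

/-- The law of `(z_1, …, z_N)`, where the `z_i = (z_i^1, …, z_i^n)` are independent centred
Gaussian vectors in `ℝ^n` with covariance matrix `Δ`. -/
def fieldLaw {n : ℕ} (N : ℕ) (Δ : Matrix (Fin n) (Fin n) ℝ) :
    Measure (Fin N → EuclideanSpace ℝ (Fin n)) :=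
  Measure.pi fun _ : Fin N => multivariateGaussian 0 Δ

/-- The external field `z^j = (z_1^j, …, z_N^j) ∈ ℝ^N` of the `j`-th copy. -/
def field {n N : ℕ} (z : Fin N → EuclideanSpace ℝ (Fin n)) (j : Fin n) :
    EuclideanSpace ℝ (Fin N) :=
  WithLp.toLp 2 fun i => z i j

/-- `log ∫_{Q_ε} exp (∑_{j ≤ n} (σ^j, z^j)) dλ_N^n`. -/
def logPartition {n : ℕ} (N : ℕ) (Q : Matrix (Fin n) (Fin n) ℝ) (ε : ℝ)
    (z : Fin N → EuclideanSpace ℝ (Fin n)) : ℝ :=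
  Real.log (∫ σ in overlapSet N Q ε,
    Real.exp (∑ j, inner ℝ (σ j) (field z j)) ∂productUniform n N)

/-- `½ (Tr(A Q) + Tr(A⁻¹ Δ) - n - log |A|)`. -/
def boundFunctional {n : ℕ} (Q Δ A : Matrix (Fin n) (Fin n) ℝ) : ℝ :=
  (1 / 2 : ℝ) * ((A * Q).trace + (A⁻¹ * Δ).trace - (n : ℝ) - Real.log A.det)

end SphericalModel

end

noncomputable section

namespace SphericalModel

/-! ### Product measures -/

section Product

variable {ι κ : Type*} [Fintype ι] [Fintype κ]

/-! The proof replaces the spheres by a standard Gaussian array `g` whose rescaled columns are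
uniform on the sphere, and then tilts that array. For positive definite `A`, the array with
independent rows of law N(A⁻¹zᵢ, A⁻¹) has density exp(`tiltExponent A z g`) with respect to the
standard one. This exponent depends on `g` only through its Gram matrix and through the linear term
∑(gʲ, zʲ). Where the Gram matrices of `g` and `z` are close to `Q` and `Δ`, the Hamiltonian is
therefore, up to a small multiple of N, `tiltExponent` + N·`boundFunctional Q Δ A`
(`abs_exponent_sub_tilt_le`).

Upper bound, for every `A`: the tilted law has total mass 1, so the integral over a small box around
`Q` is at most exp N(`boundFunctional` + η), uniformly over fields with Gram matrix near `Δ`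
(`eventually_partitionFn_le`).

Lower bound, for the critical `A`: by the law of large numbers the tilted rows have empirical second
moments close to A⁻¹ΔA⁻¹ + A⁻¹. This equals `Q` exactly when AQA = A + Δ, which is the stationarity
equation of the functional. The tilted law then charges the box, and the upper bound is attained
(`tendsto_fieldLaw_partitionFn_lt`). Comparing the two bounds also shows that a critical `A` is a
minimizer (`boundFunctional_le_of_critical`).

For fixed ε, cover the compact set of admissible overlap matrices by finitely many small boxes. The
largest local value dominates, so N⁻¹ log Z converges in probability to the supremum
`limitFreeEnergy` of the minimal values over the box. Singular overlap matrices contribute −∞. A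
second moment bound on the field upgrades this to convergence of expectations
(`freeEnergy_tendsto`). As ε ↓ 0 the supremum tends to the value at `Q`, since the functional is
affine in `Q` (`limitFreeEnergy_tendsto`). -/

lemma lintegral_pi_prod {α : ι → Type*} [∀ i, MeasurableSpace (α i)]
    (μ : ∀ i, Measure (α i)) [∀ i, IsProbabilityMeasure (μ i)] {f : ∀ i, α i → ENNReal}
    (hf : ∀ i, Measurable (f i)) :
    ∫⁻ x, ∏ i, f i (x i) ∂Measure.pi μ = ∏ i, ∫⁻ x, f i x ∂μ i := by
  have h := lintegral_prod_eq_prod_lintegral_of_indepFun (μ := Measure.pi μ) Finset.univ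
    (fun i (x : ∀ i, α i) => f i (x i))
    (iIndepFun_pi (X := f) (μ := μ) fun i => (hf i).aemeasurable)
    (fun i => (hf i).comp (measurable_pi_apply i))
  rw [h]
  refine Finset.prod_congr rfl fun i _ => ?_
  rw [← (measurePreserving_eval μ i).lintegral_comp (hf i)]

lemma pi_withDensity {α : ι → Type*} [∀ i, MeasurableSpace (α i)]
    (μ : ∀ i, Measure (α i)) [∀ i, IsProbabilityMeasure (μ i)] {f : ∀ i, α i → ENNReal}
    (hf : ∀ i, Measurable (f i)) [∀ i, SigmaFinite ((μ i).withDensity (f i))] :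
    Measure.pi (fun i => (μ i).withDensity (f i)) =
      (Measure.pi μ).withDensity fun x => ∏ i, f i (x i) := by
  refine Measure.pi_eq fun s hs => ?_
  rw [withDensity_apply _ (MeasurableSet.univ_pi hs), ← lintegral_indicator (MeasurableSet.univ_pi hs)]
  have : (fun x => (Set.univ.pi s).indicator (fun x => ∏ i, f i (x i)) x) =
      fun x => ∏ i, (s i).indicator (f i) (x i) := by
    funext x
    classical
    by_cases hx : x ∈ Set.univ.pi s
    · rw [Set.indicator_of_mem hx]
      exact Finset.prod_congr rfl fun i _ => (Set.indicator_of_mem (hx i trivial) _).symm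
    · rw [Set.indicator_of_notMem hx]
      have : ∃ i, x i ∉ s i := by simpa [Set.mem_pi] using hx
      obtain ⟨i, hi⟩ := this
      exact (Finset.prod_eq_zero (Finset.mem_univ i) (Set.indicator_of_notMem hi _)).symm
  rw [this, lintegral_pi_prod μ fun i => (hf i).indicator (hs i)]
  exact Finset.prod_congr rfl fun i _ => by
    rw [lintegral_indicator (hs i), withDensity_apply _ (hs i)]

/-- Both iterated products are curryings of one product over pairs of indices, and exchanging the
two coordinates preserves that product. -/
lemma pi_map_swap {X : Type*} [MeasurableSpace X] (μ : Measure X) [IsProbabilityMeasure μ] :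
    (Measure.pi fun _ : ι => Measure.pi fun _ : κ => μ).map (fun g j i => g i j) =
      Measure.pi fun _ : κ => Measure.pi fun _ : ι => μ := by
  have h1 := Measure.infinitePi_map_curry_symm (ι := ι) (κ := κ) fun _ _ => μ
  have h2 := Measure.infinitePi_map_curry (ι := κ) (κ := ι) fun _ _ => μ
  simp only [Measure.infinitePi_eq_pi] at h1 h2
  have h3 := (measurePreserving_piCongrLeft (fun _ : κ × ι => μ) (Equiv.prodComm ι κ)).map_eq
  rw [← h2, ← h3, ← h1, Measure.map_map (by fun_prop) (by fun_prop),
    Measure.map_map (by fun_prop) (by fun_prop)]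
  rfl

lemma pi_const_smul {α : ι → Type*} [∀ i, MeasurableSpace (α i)]
    (μ : ∀ i, Measure (α i)) [∀ i, IsFiniteMeasure (μ i)] {c : ENNReal}
    [∀ i, IsFiniteMeasure (c • μ i)] :
    Measure.pi (fun i => c • μ i) = c ^ Fintype.card ι • Measure.pi μ := by
  refine Measure.pi_eq fun s _ => ?_
  simp [Finset.prod_mul_distrib, Measure.pi_pi]

end Product

/-! ### The weak law of large numbers for product measures -/

/-- Chebyshev's inequality: the sum has variance N·Var f, so a deviation Nδ has probability at most
Var f / (δ²N). -/
lemma tendsto_measure_pi_average {Ω : Type*} [MeasurableSpace Ω] (μ : Measure Ω)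
    [IsProbabilityMeasure μ] {f : Ω → ℝ} (hf : MemLp f 2 μ) {δ : ℝ} (hδ : 0 < δ) :
    Tendsto (fun N : ℕ => (Measure.pi fun _ : Fin N => μ)
      {ω | δ ≤ |(∑ i, f (ω i)) / N - ∫ x, f x ∂μ|}) atTop (𝓝 0) := by
  have hbound : ∀ᶠ N : ℕ in atTop, (Measure.pi fun _ : Fin N => μ)
      {ω | δ ≤ |(∑ i, f (ω i)) / N - ∫ x, f x ∂μ|} ≤
        ENNReal.ofReal (Var[f; μ] / δ ^ 2 * (1 / (N : ℝ))) := by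
    filter_upwards [eventually_gt_atTop 0] with N hN
    have hN' : (0 : ℝ) < N := by exact_mod_cast hN
    set P := Measure.pi fun _ : Fin N => μ
    have hmem (i : Fin N) : MemLp (fun ω : Fin N → Ω => f (ω i)) 2 P :=
      hf.comp_measurePreserving (measurePreserving_eval (fun _ : Fin N => μ) i)
    have hX : MemLp (∑ i : Fin N, fun ω : Fin N → Ω => f (ω i)) 2 P :=
      memLp_finsetSum' _ fun i _ => hmem i
    have hmean : P[∑ i : Fin N, fun ω : Fin N → Ω => f (ω i)] = N * ∫ x, f x ∂μ := by
      simp only [Finset.sum_apply]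
      rw [integral_finsetSum _ fun i _ => (hmem i).integrable one_le_two]
      have (i : Fin N) : ∫ ω, f (ω i) ∂P = ∫ x, f x ∂μ := by
        have hm := (measurePreserving_eval (fun _ : Fin N => μ) i)
        conv_rhs => rw [← hm.map_eq, integral_map hm.measurable.aemeasurable (by
          rw [hm.map_eq]; exact hf.aestronglyMeasurable)]
      simp [this]
    have h := meas_ge_le_variance_div_sq hX (c := N * δ) (by positivity)
    rw [variance_sum_pi fun _ => hf, hmean] at h
    refine (measure_mono ?_).trans (h.trans (le_of_eq ?_))
    · intro ω hω
      simp only [Set.mem_ofPred_eq, Finset.sum_apply] at hω ⊢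
      have : (∑ i, f (ω i)) - N * ∫ x, f x ∂μ = N * ((∑ i, f (ω i)) / N - ∫ x, f x ∂μ) := by
        field_simp
      rw [this, abs_mul, abs_of_pos hN']
      gcongr
    · congr 1
      simp
      field_simp
  refine tendsto_of_tendsto_of_tendsto_of_le_of_le' tendsto_const_nhds ?_
    (Eventually.of_forall fun _ => zero_le) hbound
  rw [← ENNReal.ofReal_zero]
  refine ENNReal.tendsto_ofReal ?_
  simpa using tendsto_one_div_atTop_nhds_zero_nat.const_mul (Var[f; μ] / δ ^ 2)

/-- The empirical second moment matrix of the rows of `v`. -/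
def gram {N n : ℕ} (v : Fin N → Fin n → ℝ) : Matrix (Fin n) (Fin n) ℝ :=
  Matrix.of fun j k => (∑ i, v i j * v i k) / N

/-- The matrices `R` and `M` differ by less than `δ` in every entry. -/
def EntryNear {n : ℕ} (R M : Matrix (Fin n) (Fin n) ℝ) (δ : ℝ) : Prop :=
  ∀ j k, |R j k - M j k| < δ

lemma tendsto_measure_gram {Ω : Type*} [MeasurableSpace Ω] (μ : Measure Ω)
    [IsProbabilityMeasure μ] {n : ℕ} {f : Ω → Fin n → ℝ} {M : Matrix (Fin n) (Fin n) ℝ}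
    (hf : ∀ j k, MemLp (fun ω => f ω j * f ω k) 2 μ)
    (hM : ∀ j k, ∫ ω, f ω j * f ω k ∂μ = M j k) {δ : ℝ} (hδ : 0 < δ) :
    Tendsto (fun N : ℕ => (Measure.pi fun _ : Fin N => μ)
      {ω | ¬ EntryNear (gram fun i => f (ω i)) M δ}) atTop (𝓝 0) := by
  let bad (N : ℕ) (j k : Fin n) : Set (Fin N → Ω) :=
    {ω | δ ≤ |(∑ i, f (ω i) j * f (ω i) k) / N - ∫ x, f x j * f x k ∂μ|}
  have hlim : Tendsto (fun N : ℕ => ∑ j, ∑ k, (Measure.pi fun _ : Fin N => μ) (bad N j k))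
      atTop (𝓝 (∑ j : Fin n, ∑ k : Fin n, 0)) :=
    tendsto_finsetSum _ fun j _ => tendsto_finsetSum _ fun k _ =>
      tendsto_measure_pi_average μ (hf j k) hδ
  simp only [Finset.sum_const_zero] at hlim
  refine tendsto_of_tendsto_of_tendsto_of_le_of_le tendsto_const_nhds hlim
    (fun _ => zero_le) fun N => ?_
  have hsub : {ω : Fin N → Ω | ¬ EntryNear (gram fun i => f (ω i)) M δ} ⊆
      ⋃ j, ⋃ k, bad N j k := by
    intro ω hω
    simp only [EntryNear, not_forall, not_lt, Set.mem_ofPred_eq] at hω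
    obtain ⟨j, k, h⟩ := hω
    simp only [Set.mem_iUnion]
    refine ⟨j, k, ?_⟩
    rw [← hM] at h
    exact h
  exact (measure_mono hsub).trans ((measure_iUnion_fintype_le _ _).trans
      (Finset.sum_le_sum fun j _ => measure_iUnion_fintype_le _ _))

/-! ### Standard Gaussian vectors -/

/-- The law of `n` independent standard Gaussian variables. -/
def gaussianVec (n : ℕ) : Measure (Fin n → ℝ) :=
  Measure.pi fun _ => gaussianReal 0 1

instance (n : ℕ) : IsProbabilityMeasure (gaussianVec n) := by
  unfold gaussianVec; infer_instance

/-- The law of `N` independent standard Gaussian vectors in `ℝ^n`. -/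
def gaussianArray (N n : ℕ) : Measure (Fin N → Fin n → ℝ) :=
  Measure.pi fun _ => gaussianVec n

instance (N n : ℕ) : IsProbabilityMeasure (gaussianArray N n) := by
  unfold gaussianArray; infer_instance

/-! ### Densities of Gaussian vectors -/

open Matrix in
/-- The density of a standard Gaussian vector of `ℝ^n` with respect to Lebesgue measure. -/
def gaussianDensity {n : ℕ} (x : Fin n → ℝ) : ℝ :=
  (√(2 * Real.pi))⁻¹ ^ n * Real.exp (-(x ⬝ᵥ x) / 2)

lemma gaussianDensity_pos {n : ℕ} (x : Fin n → ℝ) : 0 < gaussianDensity x := by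
  unfold gaussianDensity; positivity

lemma measurable_gaussianDensity {n : ℕ} : Measurable (gaussianDensity (n := n)) := by
  unfold gaussianDensity dotProduct; fun_prop

lemma prod_gaussianPDF {n : ℕ} (x : Fin n → ℝ) :
    ∏ i, gaussianPDF 0 1 (x i) = ENNReal.ofReal (gaussianDensity x) := by
  simp only [gaussianPDF]
  rw [← ENNReal.ofReal_prod_of_nonneg fun i _ => gaussianPDFReal_nonneg _ _ _]
  congr 1
  simp only [gaussianPDFReal_def, gaussianDensity, dotProduct]
  rw [Finset.prod_mul_distrib, ← Real.exp_sum]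
  simp only [NNReal.coe_one, mul_one, sub_zero, Finset.prod_const, Finset.card_univ,
    Fintype.card_fin, neg_div, Finset.sum_neg_distrib, Finset.sum_div, pow_two]

/-- `pi_withDensity` requires probability measures as base, so the density is tensorised backwards:
Lebesgue measure on the line is the Gaussian law with density 1/pdf, the product is taken over the
Gaussian law, and the resulting density is inverted. -/
lemma gaussianVec_eq_withDensity (n : ℕ) :
    gaussianVec n = volume.withDensity fun x => ENNReal.ofReal (gaussianDensity x) := by
  have hpdf : Measurable (gaussianPDF 0 1) := measurable_gaussianPDF 0 1
  have h0 : (gaussianReal 0 1).withDensity (fun x => (gaussianPDF 0 1 x)⁻¹) = volume := by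
    rw [gaussianReal_of_var_ne_zero 0 one_ne_zero]
    exact withDensity_inv_same hpdf
      (Eventually.of_forall fun x => (gaussianPDF_pos 0 one_ne_zero x).ne')
      (Eventually.of_forall fun x => gaussianPDF_lt_top.ne)
  have : SigmaFinite ((gaussianReal 0 1).withDensity fun x => (gaussianPDF 0 1 x)⁻¹) := by
    rw [h0]; infer_instance
  have h1 : (volume : Measure (Fin n → ℝ)) =
      (gaussianVec n).withDensity fun x => (ENNReal.ofReal (gaussianDensity x))⁻¹ := by
    have h := pi_withDensity (ι := Fin n) (fun _ => gaussianReal 0 1)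
      (f := fun _ x => (gaussianPDF 0 1 x)⁻¹) (fun _ => hpdf.inv)
    rw [h0] at h
    rw [volume_pi, h]
    refine congrArg _ (funext fun x => ?_)
    rw [← prod_gaussianPDF, ENNReal.prod_inv_distrib]
    intro i _ j _ _
    exact Or.inl (gaussianPDF_pos 0 one_ne_zero _).ne'
  have hm : Measurable fun x : Fin n → ℝ => ENNReal.ofReal (gaussianDensity x) :=
    measurable_gaussianDensity.ennreal_ofReal
  have h2 := withDensity_inv_same (μ := gaussianVec n) hm.inv
    (Eventually.of_forall fun x => by simp)
    (Eventually.of_forall fun x => by simp [gaussianDensity_pos])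
  conv_lhs => rw [← h2]
  rw [h1]
  simp only [Pi.inv_apply, inv_inv]
  rfl

open Matrix in
-- Linear change of variables. The image is compared with the Gaussian law itself rather than with
-- Lebesgue measure, so the density is the Jacobian times a ratio of two Gaussian densities.
lemma gaussianVec_map_affine {n : ℕ} (m : Fin n → ℝ) (B : Matrix (Fin n) (Fin n) ℝ)
    (hB : B.det ≠ 0) :
    (gaussianVec n).map (fun y => m + B *ᵥ y) =
      (gaussianVec n).withDensity fun y => ENNReal.ofReal (|B.det|⁻¹ *
        Real.exp ((y ⬝ᵥ y) / 2 - ((B⁻¹ *ᵥ (y - m)) ⬝ᵥ (B⁻¹ *ᵥ (y - m))) / 2)) := by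
  have hU : IsUnit B.det := isUnit_iff_ne_zero.mpr hB
  have hme : Measurable fun y : Fin n → ℝ => m + B *ᵥ y := by
    unfold Matrix.mulVec dotProduct; fun_prop
  have hmi : Measurable fun y : Fin n → ℝ => B⁻¹ *ᵥ (y - m) := by
    unfold Matrix.mulVec dotProduct; fun_prop
  have hdot : Measurable fun y : Fin n → ℝ => y ⬝ᵥ y := by
    unfold dotProduct; fun_prop
  have hvol : (volume : Measure (Fin n → ℝ)).map (fun y => m + B *ᵥ y) =
      ENNReal.ofReal |B.det|⁻¹ • volume := by
    have h := Real.map_matrix_volume_pi_eq_smul_volume_pi hB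
    have hc : (fun y : Fin n → ℝ => m + B *ᵥ y) = (fun y => m + y) ∘ Matrix.toLin' B := by
      funext y; simp
    have hmB : Measurable (Matrix.toLin' B) := by
      have : ⇑(Matrix.toLin' B) = fun y => B *ᵥ y := by funext y; simp
      rw [this]
      unfold Matrix.mulVec dotProduct; fun_prop
    rw [hc, ← Measure.map_map (measurable_const_add m) hmB, h, Measure.map_smul, map_add_left_eq_self,
      abs_inv]
  have hD : Measurable fun y : Fin n → ℝ => ENNReal.ofReal (|B.det|⁻¹ *
      Real.exp ((y ⬝ᵥ y) / 2 - ((B⁻¹ *ᵥ (y - m)) ⬝ᵥ (B⁻¹ *ᵥ (y - m))) / 2)) :=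
    ((((hdot.div_const 2).sub ((hdot.comp hmi).div_const 2)).exp).const_mul _).ennreal_ofReal
  have hg : Measurable fun x : Fin n → ℝ => ENNReal.ofReal (gaussianDensity x) :=
    measurable_gaussianDensity.ennreal_ofReal
  refine Measure.ext_of_lintegral _ fun φ hφ => ?_
  rw [lintegral_map hφ hme, lintegral_withDensity_eq_lintegral_mul _ hD hφ,
    gaussianVec_eq_withDensity, lintegral_withDensity_eq_lintegral_mul _ hg
      (show Measurable fun y => φ (m + B *ᵥ y) from hφ.comp hme),
    lintegral_withDensity_eq_lintegral_mul _ hg (hD.mul hφ)]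
  have hgφ : Measurable fun x => ENNReal.ofReal (gaussianDensity (B⁻¹ *ᵥ (x - m))) * φ x :=
    (hg.comp hmi).mul hφ
  have key (y : Fin n → ℝ) : B⁻¹ *ᵥ (m + B *ᵥ y - m) = y := by
    rw [add_sub_cancel_left, Matrix.mulVec_mulVec, Matrix.nonsing_inv_mul _ hU, Matrix.one_mulVec]
  calc _ = ∫⁻ y, (fun x => ENNReal.ofReal (gaussianDensity (B⁻¹ *ᵥ (x - m))) * φ x)
        (m + B *ᵥ y) := by
        refine lintegral_congr fun y => ?_
        simp only [Pi.mul_apply]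
        rw [key]
    _ = ∫⁻ x, ENNReal.ofReal (gaussianDensity (B⁻¹ *ᵥ (x - m))) * φ x
          ∂(ENNReal.ofReal |B.det|⁻¹ • volume) := by
        rw [← hvol, lintegral_map hgφ hme]
    _ = _ := by
        rw [lintegral_smul_measure, smul_eq_mul, ← lintegral_const_mul _ hgφ]
        refine lintegral_congr fun x => ?_
        simp only [Pi.mul_apply]
        rw [← mul_assoc, ← mul_assoc, ← ENNReal.ofReal_mul (by positivity),
          ← ENNReal.ofReal_mul (gaussianDensity_pos _).le]
        congr 2
        simp only [gaussianDensity]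
        have : Real.exp (-((B⁻¹ *ᵥ (x - m)) ⬝ᵥ (B⁻¹ *ᵥ (x - m))) / 2) = Real.exp (-(x ⬝ᵥ x) / 2) *
            Real.exp ((x ⬝ᵥ x) / 2 - ((B⁻¹ *ᵥ (x - m)) ⬝ᵥ (B⁻¹ *ᵥ (x - m))) / 2) := by
          rw [← Real.exp_add]; congr 1; ring
        rw [this]; ring

/-! ### Polar coordinates -/

section Polar

variable {E : Type*} [NormedAddCommGroup E] [NormedSpace ℝ E] [MeasurableSpace E] [BorelSpace E]
  [FiniteDimensional ℝ E] [Nontrivial E]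

lemma lintegral_polar (μ : Measure E) [μ.IsAddHaarMeasure] {h : ℝ → ENNReal} (hh : Measurable h)
    {f : E → ENNReal} (hf : Measurable f) :
    ∫⁻ x, h ‖x‖ * f (‖x‖⁻¹ • x) ∂μ =
      (∫⁻ r, h r ∂Measure.volumeIoiPow (Module.finrank ℝ E - 1)) * ∫⁻ s, f s ∂μ.toSphere := by
  calc ∫⁻ x, h ‖x‖ * f (‖x‖⁻¹ • x) ∂μ
      = ∫⁻ x : ({(0 : E)}ᶜ : Set E), h ‖x.1‖ * f (‖x.1‖⁻¹ • x.1) ∂(μ.comap (↑)) := by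
        rw [lintegral_subtype_comap (measurableSet_singleton _).compl
          (fun x => h ‖x‖ * f (‖x‖⁻¹ • x)), restrict_compl_singleton]
    _ = ∫⁻ p, h p.2 * f p.1
          ∂(μ.toSphere.prod (Measure.volumeIoiPow (Module.finrank ℝ E - 1))) := by
        rw [← μ.measurePreserving_homeomorphUnitSphereProd.lintegral_comp_emb
          (Homeomorph.measurableEmbedding _)]
        simp only [homeomorphUnitSphereProd_apply_snd_coe, homeomorphUnitSphereProd_apply_fst_coe]
    _ = _ := by
        rw [lintegral_prod_symm' _ (by fun_prop)]
        simp only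
        rw [← lintegral_mul_const _ (by fun_prop)]
        refine lintegral_congr fun r => ?_
        rw [lintegral_const_mul _ (by fun_prop)]

end Polar

instance (N : ℕ) : IsProbabilityMeasure ((gaussianVec N).map (WithLp.toLp 2)) :=
  Measure.isProbabilityMeasure_map (by fun_prop)

lemma gaussianVec_map_toLp (N : ℕ) :
    (gaussianVec N).map (WithLp.toLp 2) =
      (volume : Measure (EuclideanSpace ℝ (Fin N))).withDensity fun x =>
        ENNReal.ofReal ((√(2 * Real.pi))⁻¹ ^ N * Real.exp (-‖x‖ ^ 2 / 2)) := by
  refine Measure.ext_of_lintegral _ fun φ hφ => ?_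
  rw [lintegral_map hφ (by fun_prop), gaussianVec_eq_withDensity,
    lintegral_withDensity_eq_lintegral_mul _ measurable_gaussianDensity.ennreal_ofReal
      (show Measurable fun x => φ (WithLp.toLp 2 x) from hφ.comp (by fun_prop)),
    lintegral_withDensity_eq_lintegral_mul _ (by fun_prop) hφ,
    ← (PiLp.volume_preserving_toLp (Fin N)).lintegral_comp (by fun_prop)]
  refine lintegral_congr fun x => ?_
  simp only [Pi.mul_apply, gaussianDensity]
  rw [EuclideanSpace.real_norm_sq_eq]
  simp [dotProduct, pow_two]

/-- The multiple of `x` that lies on the sphere of radius `√N`. -/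
def toSphereRadius {N : ℕ} (x : EuclideanSpace ℝ (Fin N)) : EuclideanSpace ℝ (Fin N) :=
  (√(N : ℝ) / ‖x‖) • x

lemma measurable_toSphereRadius {N : ℕ} : Measurable (toSphereRadius (N := N)) := by
  unfold toSphereRadius; fun_prop

/-- The Gaussian density is radial, so the direction is uniform and independent of the norm;
conditioning the norm to lie in `I` only contributes a mass factor. -/
lemma map_toSphereRadius_restrict {N : ℕ} (hN : 0 < N) {I : Set ℝ} (hI : MeasurableSet I) :
    (((gaussianVec N).map (WithLp.toLp 2)).restrict {x | ‖x‖ ∈ I}).map toSphereRadius =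
      ((gaussianVec N).map (WithLp.toLp 2)) {x | ‖x‖ ∈ I} • sphereUniform N := by
  have : NeZero N := ⟨hN.ne'⟩
  have hIm : MeasurableSet {x : EuclideanSpace ℝ (Fin N) | ‖x‖ ∈ I} := measurable_norm hI
  set ω := (volume : Measure (EuclideanSpace ℝ (Fin N))).toSphere with hω
  set d : ℝ → ENNReal := fun r => ENNReal.ofReal ((√(2 * Real.pi))⁻¹ ^ N * Real.exp (-r ^ 2 / 2))
  have hd : Measurable d := by fun_prop
  have hid : Measurable (I.indicator d) := hd.indicator hI
  have polar {f : EuclideanSpace ℝ (Fin N) → ENNReal} (hf : Measurable f) :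
      ∫⁻ x in {x | ‖x‖ ∈ I}, f (toSphereRadius x) ∂((gaussianVec N).map (WithLp.toLp 2)) =
      (∫⁻ r, I.indicator d r ∂Measure.volumeIoiPow
        (Module.finrank ℝ (EuclideanSpace ℝ (Fin N)) - 1)) *
        ∫⁻ s, f (√(N : ℝ) • (s : EuclideanSpace ℝ (Fin N))) ∂ω := by
    have hf' : Measurable fun x : EuclideanSpace ℝ (Fin N) => f (√(N : ℝ) • x) := by fun_prop
    rw [hω, ← lintegral_polar volume hid hf', gaussianVec_map_toLp,
      restrict_withDensity hIm,
      lintegral_withDensity_eq_lintegral_mul _ (by fun_prop)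
        (show Measurable fun x => f (toSphereRadius x) from hf.comp measurable_toSphereRadius),
      ← lintegral_indicator hIm]
    refine lintegral_congr fun x => ?_
    by_cases hx : ‖x‖ ∈ I
    · rw [Set.indicator_of_mem (show x ∈ {x | ‖x‖ ∈ I} from hx), Set.indicator_of_mem hx]
      simp only [Pi.mul_apply, toSphereRadius, smul_smul, div_eq_mul_inv, d]
    · rw [Set.indicator_of_notMem (show x ∉ {x | ‖x‖ ∈ I} from hx), Set.indicator_of_notMem hx,
        zero_mul]
  have hω0 : ω Set.univ ≠ 0 := by
    rw [Ne, Measure.measure_univ_eq_zero]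
    exact Measure.toSphere_ne_zero _
  -- Testing against the constant 1 identifies the radial integral, up to the surface mass of the
  -- unit sphere, with the Gaussian mass of the shell.
  have hmass := polar (f := fun _ => 1) measurable_const
  simp only [lintegral_const, Measure.restrict_apply_univ, one_mul] at hmass
  refine Measure.ext_of_lintegral _ fun f hf => ?_
  rw [lintegral_map hf measurable_toSphereRadius, polar hf, lintegral_smul_measure, hmass,
    sphereUniform, lintegral_map hf (by fun_prop), lintegral_smul_measure, smul_eq_mul, smul_eq_mul]
  rw [mul_assoc, ← mul_assoc (ω Set.univ), ENNReal.mul_inv_cancel hω0 (measure_ne_top _ _), one_mul]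

lemma isProbabilityMeasure_sphereUniform {N : ℕ} (hN : 0 < N) :
    IsProbabilityMeasure (sphereUniform N) := by
  have h := map_toSphereRadius_restrict hN MeasurableSet.univ
  simp only [Set.mem_univ, Set.ofPred_true, Measure.restrict_univ, measure_univ, one_smul] at h
  rw [← h]
  exact Measure.isProbabilityMeasure_map measurable_toSphereRadius.aemeasurable

/-! ### Arrays of Gaussian vectors and the product of spheres -/

/-- The `j`-th column of an array, as a vector of `ℝ^N`. -/
def column {N n : ℕ} (g : Fin N → Fin n → ℝ) (j : Fin n) : EuclideanSpace ℝ (Fin N) :=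
  WithLp.toLp 2 fun i => g i j

/-- The columns of an array, rescaled to the sphere of radius `√N`. -/
def sphereColumns {N n : ℕ} (g : Fin N → Fin n → ℝ) (j : Fin n) : EuclideanSpace ℝ (Fin N) :=
  toSphereRadius (column g j)

lemma measurable_column {N n : ℕ} (j : Fin n) :
    Measurable fun g : Fin N → Fin n → ℝ => column g j := by
  unfold column; fun_prop

lemma measurable_sphereColumns {N n : ℕ} :
    Measurable (sphereColumns : (Fin N → Fin n → ℝ) → _) :=
  measurable_pi_lambda _ fun j => measurable_toSphereRadius.comp (measurable_column j)

lemma gaussianArray_map_column (N n : ℕ) :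
    (gaussianArray N n).map column =
      Measure.pi fun _ : Fin n => (gaussianVec N).map (WithLp.toLp 2) := by
  have h1 : (gaussianArray N n).map (fun g j i => g i j) = gaussianArray n N :=
    pi_map_swap (gaussianReal 0 1)
  rw [← Measure.pi_map_pi (fun _ => by fun_prop)]
  change _ = (gaussianArray n N).map _
  rw [← h1, Measure.map_map (by fun_prop) (by fun_prop)]
  rfl

lemma map_sphereColumns_restrict {N : ℕ} (n : ℕ) (hN : 0 < N) {I : Set ℝ} (hI : MeasurableSet I) :
    ((gaussianArray N n).restrict {g | ∀ j, ‖column g j‖ ∈ I}).map sphereColumns =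
      ((gaussianVec N).map (WithLp.toLp 2)) {x | ‖x‖ ∈ I} ^ n • productUniform n N := by
  have := isProbabilityMeasure_sphereUniform hN
  set γ := (gaussianVec N).map (WithLp.toLp 2) with hγ
  have hIm : MeasurableSet {x : EuclideanSpace ℝ (Fin N) | ‖x‖ ∈ I} := measurable_norm hI
  have hcol : Measurable (column : (Fin N → Fin n → ℝ) → _) :=
    measurable_pi_lambda _ measurable_column
  have hset : {g : Fin N → Fin n → ℝ | ∀ j, ‖column g j‖ ∈ I} =
      column ⁻¹' (Set.univ.pi fun _ => {x | ‖x‖ ∈ I}) := by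
    ext g; simp
  have hfin : IsFiniteMeasure (γ {x | ‖x‖ ∈ I} • sphereUniform N) :=
    Measure.smul_finite _ (measure_ne_top _ _)
  have hmap := map_toSphereRadius_restrict hN hI
  rw [← hγ] at hmap
  have h1 : (fun σ : Fin n → EuclideanSpace ℝ (Fin N) => fun j => toSphereRadius (σ j)) ∘ column =
    (sphereColumns : (Fin N → Fin n → ℝ) → _) := rfl
  have hr : Measurable fun σ : Fin n → EuclideanSpace ℝ (Fin N) => fun j => toSphereRadius (σ j) :=
    measurable_pi_lambda _ fun j => measurable_toSphereRadius.comp (measurable_pi_apply j)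
  rw [← h1, ← Measure.map_map hr hcol, hset,
    ← Measure.restrict_map hcol (MeasurableSet.univ_pi fun _ => hIm), gaussianArray_map_column,
    Measure.restrict_pi_pi]
  have : SigmaFinite ((γ.restrict {x | ‖x‖ ∈ I}).map toSphereRadius) := by
    rw [hmap]; infer_instance
  rw [Measure.pi_map_pi (fun _ => measurable_toSphereRadius.aemeasurable)]
  rw [← hγ, hmap, pi_const_smul, Fintype.card_fin]
  rfl

/-! ### Tilting a Gaussian array -/

open Matrix

lemma exists_sqrt_inv {n : ℕ} {A : Matrix (Fin n) (Fin n) ℝ} (hA : A.PosDef) :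
    ∃ B : Matrix (Fin n) (Fin n) ℝ, Bᵀ = B ∧ B * B = A⁻¹ := by
  open scoped MatrixOrder in
  have h := hA.inv.posSemidef.nonneg
  refine ⟨CFC.sqrt A⁻¹, ?_, CFC.sqrt_mul_sqrt_self _ h⟩
  have := (CFC.sqrt_nonneg A⁻¹).posSemidef.1
  simpa [Matrix.IsHermitian] using this

/-- Complete the square: with B² = A⁻¹ the whitened quadratic form is (y − A⁻¹z)·A(y − A⁻¹z), and
|det B|⁻¹ = √(det A). -/
lemma gaussianVec_map_tilt {n : ℕ} {A B : Matrix (Fin n) (Fin n) ℝ} (hA : A.PosDef)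
    (hBt : Bᵀ = B) (hB : B * B = A⁻¹) (z : Fin n → ℝ) :
    (gaussianVec n).map (fun y => A⁻¹ *ᵥ z + B *ᵥ y) =
      (gaussianVec n).withDensity fun y => ENNReal.ofReal (Real.exp
        ((y ⬝ᵥ y) / 2 - (y ⬝ᵥ A *ᵥ y) / 2 + y ⬝ᵥ z - (z ⬝ᵥ A⁻¹ *ᵥ z) / 2 + Real.log A.det / 2)) := by
  have hAd : 0 < A.det := hA.det_pos
  have hAu : IsUnit A.det := isUnit_iff_ne_zero.mpr hAd.ne'
  have hdet : B.det * B.det = A.det⁻¹ := by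
    rw [← det_mul, hB, det_nonsing_inv, Ring.inverse_eq_inv']
  have hBd : B.det ≠ 0 := by
    intro h
    rw [h, zero_mul] at hdet
    exact (inv_pos.mpr hAd).ne hdet
  have hAt : Aᵀ = A := by simpa [Matrix.IsHermitian] using hA.1
  rw [gaussianVec_map_affine _ _ hBd]
  refine congrArg _ (funext fun y => congrArg _ ?_)
  have hd : |B.det|⁻¹ = Real.exp (Real.log A.det / 2) := by
    have h2 : Real.exp (Real.log A.det / 2) * Real.exp (Real.log A.det / 2) = A.det := by
      rw [← Real.exp_add, add_halves, Real.exp_log hAd]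
    have h3 : |B.det|⁻¹ * |B.det|⁻¹ = A.det := by
      rw [← mul_inv, abs_mul_abs_self, hdet, inv_inv]
    exact (mul_self_inj (by positivity) (by positivity)).mp (h3.trans h2.symm)
  rw [hd, ← Real.exp_add]
  congr 1
  have hw : (B⁻¹ *ᵥ (y - A⁻¹ *ᵥ z)) ⬝ᵥ (B⁻¹ *ᵥ (y - A⁻¹ *ᵥ z)) =
      (y - A⁻¹ *ᵥ z) ⬝ᵥ A *ᵥ (y - A⁻¹ *ᵥ z) := by
    have hBi : (B⁻¹)ᵀ * B⁻¹ = A := by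
      rw [transpose_nonsing_inv, hBt, ← Matrix.mul_inv_rev, hB, nonsing_inv_nonsing_inv _ hAu]
    rw [dotProduct_mulVec, vecMul_mulVec, hBi, dotProduct_comm, dotProduct_mulVec,
      ← mulVec_transpose, hAt, dotProduct_comm]
  have hcross : (A⁻¹ *ᵥ z) ⬝ᵥ A *ᵥ y = y ⬝ᵥ z := by
    rw [dotProduct_mulVec, ← mulVec_transpose, hAt, mulVec_mulVec, mul_nonsing_inv _ hAu,
      one_mulVec, dotProduct_comm]
  rw [hw, mulVec_sub, mulVec_mulVec, mul_nonsing_inv _ hAu, one_mulVec, dotProduct_sub,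
    sub_dotProduct, sub_dotProduct, hcross, dotProduct_comm (A⁻¹ *ᵥ z) z]
  ring

/-- The logarithm of the density, with respect to the law of a standard Gaussian array, of the law
of the array with independent rows of law `N(A⁻¹ zᵢ, A⁻¹)`. -/
def tiltExponent {N n : ℕ} (A : Matrix (Fin n) (Fin n) ℝ) (z g : Fin N → Fin n → ℝ) : ℝ :=
  N / 2 * ((gram g).trace - (A * gram g).trace - (A⁻¹ * gram z).trace + Real.log A.det) +
    ∑ j, inner ℝ (column g j) (column z j)

lemma sum_dotProduct_mulVec {N n : ℕ} (hN : 0 < N) (A : Matrix (Fin n) (Fin n) ℝ)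
    (g : Fin N → Fin n → ℝ) : ∑ i, g i ⬝ᵥ A *ᵥ g i = N * (A * gram g).trace := by
  have hN' : (N : ℝ) ≠ 0 := by exact_mod_cast hN.ne'
  simp only [Matrix.trace, Matrix.diag, Matrix.mul_apply, gram, of_apply, dotProduct, mulVec,
    Finset.mul_sum]
  rw [Finset.sum_comm]
  refine Finset.sum_congr rfl fun j _ => ?_
  rw [Finset.sum_comm]
  refine Finset.sum_congr rfl fun k _ => ?_
  rw [mul_div_assoc', mul_div_assoc', mul_comm (A j k), ← mul_assoc, mul_assoc, Finset.sum_mul,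
    eq_div_iff hN', mul_comm]
  congr 1
  exact Finset.sum_congr rfl fun i _ => by ring

lemma sum_inner_column {N n : ℕ} (g z : Fin N → Fin n → ℝ) :
    ∑ j, inner ℝ (column g j) (column z j) = ∑ i, g i ⬝ᵥ z i := by
  simp only [column, PiLp.inner_apply, dotProduct]
  rw [Finset.sum_comm]
  simp [mul_comm]

lemma gaussianArray_map_tilt {N n : ℕ} (hN : 0 < N) {A B : Matrix (Fin n) (Fin n) ℝ}
    (hA : A.PosDef) (hBt : Bᵀ = B) (hB : B * B = A⁻¹) (z : Fin N → Fin n → ℝ) :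
    (gaussianArray N n).map (fun g i => A⁻¹ *ᵥ z i + B *ᵥ g i) =
      (gaussianArray N n).withDensity fun g => ENNReal.ofReal (Real.exp (tiltExponent A z g)) := by
  have hm (i : Fin N) : Measurable fun y : Fin n → ℝ => A⁻¹ *ᵥ z i + B *ᵥ y := by
    unfold Matrix.mulVec dotProduct; fun_prop
  have hp (i : Fin N) : IsProbabilityMeasure
      ((gaussianVec n).map fun y => A⁻¹ *ᵥ z i + B *ᵥ y) :=
    Measure.isProbabilityMeasure_map (hm i).aemeasurable
  have hs (i : Fin N) := hp i
  simp only [gaussianVec_map_tilt hA hBt hB] at hs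
  unfold gaussianArray
  rw [Measure.pi_map_pi (f := fun i y => A⁻¹ *ᵥ z i + B *ᵥ y) fun i => (hm i).aemeasurable]
  simp only [gaussianVec_map_tilt hA hBt hB]
  rw [pi_withDensity]
  · refine congrArg _ (funext fun g => ?_)
    rw [← ENNReal.ofReal_prod_of_nonneg fun i _ => (Real.exp_pos _).le, ← Real.exp_sum]
    congr 2
    have h1 := sum_dotProduct_mulVec hN 1 g
    simp only [one_mulVec, one_mul] at h1
    simp only [Finset.sum_add_distrib, Finset.sum_sub_distrib, ← Finset.sum_div]
    rw [h1, sum_dotProduct_mulVec hN, sum_dotProduct_mulVec hN, ← sum_inner_column, tiltExponent]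
    simp
    ring
  · intro i
    unfold Matrix.mulVec dotProduct; fun_prop

/-! ### Gram matrices and overlaps -/

section Overlap

variable {N n : ℕ}

lemma overlap_column (g : Fin N → Fin n → ℝ) (j k : Fin n) :
    overlap (column g j) (column g k) = gram g j k := by
  simp [overlap, column, gram, PiLp.inner_apply, mul_comm]

lemma norm_column_sq (hN : 0 < N) (g : Fin N → Fin n → ℝ) (j : Fin n) :
    ‖column g j‖ ^ 2 = N * gram g j j := by
  rw [← overlap_column, overlap, real_inner_self_eq_norm_sq]
  field_simp

lemma norm_column (hN : 0 < N) (g : Fin N → Fin n → ℝ) (j : Fin n) :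
    ‖column g j‖ = √N * √(gram g j j) := by
  rw [← Real.sqrt_mul (Nat.cast_nonneg _), ← norm_column_sq hN, Real.sqrt_sq (norm_nonneg _)]

lemma overlap_smul (a b : ℝ) (x y : EuclideanSpace ℝ (Fin N)) :
    overlap (a • x) (b • y) = a * b * overlap x y := by
  simp only [overlap, real_inner_smul_left, real_inner_smul_right]
  ring

lemma abs_overlap_le_one (hN : 0 < N) {x y : EuclideanSpace ℝ (Fin N)} (hx : ‖x‖ = √N)
    (hy : ‖y‖ = √N) : |overlap x y| ≤ 1 := by
  have hN' : (0 : ℝ) < N := by exact_mod_cast hN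
  rw [overlap, abs_div, abs_of_pos hN', div_le_one hN']
  refine (abs_real_inner_le_norm x y).trans ?_
  rw [hx, hy, Real.mul_self_sqrt hN'.le]

lemma norm_sphereColumns (g : Fin N → Fin n → ℝ) {j : Fin n} (hj : column g j ≠ 0) :
    ‖sphereColumns g j‖ = √N := by
  rw [sphereColumns, toSphereRadius, norm_smul, norm_div, norm_norm, Real.norm_of_nonneg (by simp)]
  field_simp [norm_ne_zero_iff.mpr hj]

/-- With a, b the norm ratios of the two columns, the Gram entry is ab times the overlap. The
overlap is at most 1 in absolute value, and |ab − 1| ≤ κ² + 2κ ≤ 3κ. -/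
lemma abs_gram_sub_overlap_le (hN : 0 < N) {κ : ℝ} (hκ : κ < 1)
    (g : Fin N → Fin n → ℝ) (hg : ∀ j, |‖column g j‖ / √N - 1| ≤ κ) (j k : Fin n) :
    |gram g j k - overlap (sphereColumns g j) (sphereColumns g k)| ≤ 3 * κ := by
  have hN' : (0 : ℝ) < √N := Real.sqrt_pos.mpr (by exact_mod_cast hN)
  have hpos (j : Fin n) : 0 < ‖column g j‖ := by
    by_contra h
    have h0 : ‖column g j‖ = 0 := le_antisymm (not_lt.mp h) (norm_nonneg _)
    have := hg j
    rw [h0] at this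
    norm_num at this
    linarith
  have hκ0 : 0 ≤ κ := (abs_nonneg _).trans (hg j)
  have hcol (j : Fin n) : column g j = (‖column g j‖ / √N) • sphereColumns g j := by
    have := (hpos j).ne'
    rw [sphereColumns, toSphereRadius, smul_smul]
    field_simp
    simp
  have h1 := abs_overlap_le_one hN (norm_sphereColumns g (norm_pos_iff.mp (hpos j)))
    (norm_sphereColumns g (norm_pos_iff.mp (hpos k)))
  have e : gram g j k = (‖column g j‖ / √N) * (‖column g k‖ / √N) *
      overlap (sphereColumns g j) (sphereColumns g k) := by
    rw [← overlap_column, ← overlap_smul, ← hcol, ← hcol]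
  rw [e]
  generalize overlap (sphereColumns g j) (sphereColumns g k) = R at h1
  have ha := hg j
  have hb := hg k
  generalize ‖column g j‖ / √N = a at ha
  generalize ‖column g k‖ / √N = b at hb
  have h2 : a * b * R - R = (a * b - 1) * R := by ring
  rw [h2, abs_mul]
  have h3 : |a * b - 1| ≤ 3 * κ := by
    have : a * b - 1 = (a - 1) * (b - 1) + (a - 1) + (b - 1) := by ring
    rw [this]
    have h4 : |(a - 1) * (b - 1)| ≤ κ * 1 := by
      rw [abs_mul]; gcongr; linarith
    linarith [abs_add_three ((a - 1) * (b - 1)) (a - 1) (b - 1)]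
  calc _ ≤ 3 * κ * 1 := by gcongr
    _ = _ := by ring

/-- For a ≥ 0 one has |a² − 1| = |a − 1|(a + 1) ≥ |a − 1|. -/
lemma abs_norm_column_div_sub_one_le (hN : 0 < N) (g : Fin N → Fin n → ℝ) (j : Fin n) :
    |‖column g j‖ / √N - 1| ≤ |gram g j j - 1| := by
  have hN' : (0 : ℝ) < N := by exact_mod_cast hN
  have h : (‖column g j‖ / √N) ^ 2 = gram g j j := by
    rw [div_pow, norm_column_sq hN, Real.sq_sqrt hN'.le]; field_simp
  have h0 : 0 ≤ ‖column g j‖ / √N := by positivity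
  rw [← h]
  have : (‖column g j‖ / √N) ^ 2 - 1 = (‖column g j‖ / √N - 1) * (‖column g j‖ / √N + 1) := by ring
  rw [this, abs_mul]
  refine le_mul_of_one_le_right (abs_nonneg _) ?_
  rw [abs_of_nonneg (by linarith)]
  linarith

end Overlap

/-! ### The partition function and its comparison with a tilted Gaussian measure -/

/-- The integral `∫_{Q_ε} exp (∑_j (σ^j, w^j)) dλ_N^n`, where `w^j` are the columns of `w`. -/
def partitionFn {n : ℕ} (N : ℕ) (Q : Matrix (Fin n) (Fin n) ℝ) (ε : ℝ)
    (w : Fin N → Fin n → ℝ) : ENNReal :=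
  ∫⁻ σ in overlapSet N Q ε, ENNReal.ofReal (Real.exp (∑ j, inner ℝ (σ j) (column w j)))
    ∂productUniform n N

lemma isClosed_overlapSet {n : ℕ} (N : ℕ) (Q : Matrix (Fin n) (Fin n) ℝ) (ε : ℝ) :
    IsClosed (overlapSet N Q ε) := by
  have h1 : IsClosed {σ : Fin n → EuclideanSpace ℝ (Fin N) |
      ∀ j, σ j ∈ Metric.sphere (0 : EuclideanSpace ℝ (Fin N)) (√(N : ℝ))} := by
    simp only [Set.ofPred_forall]
    exact isClosed_iInter fun j => Metric.isClosed_sphere.preimage (continuous_apply j)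
  have h2 : IsClosed {σ : Fin n → EuclideanSpace ℝ (Fin N) |
      ∀ j j', overlap (σ j) (σ j') ∈ Set.Icc (Q j j' - ε) (Q j j' + ε)} := by
    simp only [Set.ofPred_forall]
    refine isClosed_iInter fun j => isClosed_iInter fun k => isClosed_Icc.preimage ?_
    unfold overlap
    fun_prop
  exact h1.inter h2

lemma measurable_exp_sum_inner {N n : ℕ} (w : Fin N → Fin n → ℝ) :
    Measurable fun σ : Fin n → EuclideanSpace ℝ (Fin N) =>
      ENNReal.ofReal (Real.exp (∑ j, inner ℝ (σ j) (column w j))) := by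
  fun_prop

lemma lintegral_sphereColumns {N n : ℕ} (hN : 0 < N) {I : Set ℝ} (hI : MeasurableSet I)
    (Q : Matrix (Fin n) (Fin n) ℝ) (ε : ℝ) (w : Fin N → Fin n → ℝ) :
    ((gaussianVec N).map (WithLp.toLp 2)) {x | ‖x‖ ∈ I} ^ n * partitionFn N Q ε w =
      ∫⁻ g in {g | (∀ j, ‖column g j‖ ∈ I) ∧ sphereColumns g ∈ overlapSet N Q ε},
        ENNReal.ofReal (Real.exp (∑ j, inner ℝ (sphereColumns g j) (column w j)))
        ∂gaussianArray N n := by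
  have hO := (isClosed_overlapSet N Q ε).measurableSet
  have hIm : MeasurableSet {g : Fin N → Fin n → ℝ | ∀ j, ‖column g j‖ ∈ I} := by
    simp only [Set.ofPred_forall]
    exact MeasurableSet.iInter fun j => (measurable_column j).norm hI
  rw [partitionFn, ← smul_eq_mul, ← lintegral_smul_measure, ← Measure.restrict_smul,
    ← map_sphereColumns_restrict n hN hI, setLIntegral_map hO (measurable_exp_sum_inner w)
      measurable_sphereColumns, Measure.restrict_restrict (measurable_sphereColumns hO)]
  congr 2
  ext g
  exact and_comm

lemma lintegral_tilt {N n : ℕ} (hN : 0 < N) {A : Matrix (Fin n) (Fin n) ℝ} (hA : A.PosDef)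
    (z : Fin N → Fin n → ℝ) :
    ∫⁻ g, ENNReal.ofReal (Real.exp (tiltExponent A z g)) ∂gaussianArray N n = 1 := by
  obtain ⟨B, hBt, hB⟩ := exists_sqrt_inv hA
  rw [← setLIntegral_univ, ← withDensity_apply _ MeasurableSet.univ,
    ← gaussianArray_map_tilt hN hA hBt hB z]
  have : Measurable fun (g : Fin N → Fin n → ℝ) i => A⁻¹ *ᵥ z i + B *ᵥ g i := by
    unfold mulVec dotProduct; fun_prop
  rw [Measure.map_apply this MeasurableSet.univ]
  simp

/-- The sum of the absolute values of the entries of a matrix. -/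
def entrySum {n : ℕ} (A : Matrix (Fin n) (Fin n) ℝ) : ℝ := ∑ j, ∑ k, |A j k|

lemma entrySum_nonneg {n : ℕ} (A : Matrix (Fin n) (Fin n) ℝ) : 0 ≤ entrySum A :=
  Finset.sum_nonneg fun _ _ => Finset.sum_nonneg fun _ _ => abs_nonneg _

lemma abs_trace_mul_sub_le {n : ℕ} (A : Matrix (Fin n) (Fin n) ℝ) {R M : Matrix (Fin n) (Fin n) ℝ}
    {δ : ℝ} (h : EntryNear R M δ) :
    |(A * R).trace - (A * M).trace| ≤ entrySum A * δ := by
  rw [← trace_sub, ← mul_sub]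
  simp only [trace, diag, mul_apply, entrySum, Finset.sum_mul]
  refine (Finset.abs_sum_le_sum_abs _ _).trans (Finset.sum_le_sum fun j _ =>
    (Finset.abs_sum_le_sum_abs _ _).trans (Finset.sum_le_sum fun k _ => ?_))
  rw [abs_mul]
  gcongr
  exact (h k j).le

/-- The constant in the comparison of the exponent with the tilting exponent. -/
def comparisonConst {n : ℕ} (Δ A : Matrix (Fin n) (Fin n) ℝ) : ℝ :=
  n + entrySum A + entrySum A⁻¹ + ∑ j, √(|Δ j j| + 1)

lemma comparisonConst_nonneg {n : ℕ} (Δ A : Matrix (Fin n) (Fin n) ℝ) :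
    0 ≤ comparisonConst Δ A := by
  have := entrySum_nonneg A
  have := entrySum_nonneg A⁻¹
  unfold comparisonConst
  positivity

lemma norm_column_le_of_entryNear {N n : ℕ} (hN : 0 < N) {Δ : Matrix (Fin n) (Fin n) ℝ}
    {z : Fin N → Fin n → ℝ} {δ : ℝ} (hδ : δ ≤ 1) (hz : EntryNear (gram z) Δ δ) (j : Fin n) :
    ‖column z j‖ ≤ √N * √(|Δ j j| + 1) := by
  rw [norm_column hN]
  gcongr
  have := (abs_lt.mp (hz j j)).2
  linarith [le_abs_self (Δ j j)]

/-- Replacing the Gram matrix of `g` by `Q`, with trace n, and that of `z` by `Δ` turns the part of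
`tiltExponent` other than the linear term into −N·`boundFunctional Q Δ A`. The linear term survives
up to the rescaling of the columns, and every error is linear in `r` and `δ`. -/
lemma abs_exponent_sub_tilt_le {N n : ℕ} (hN : 0 < N) {Q Δ A : Matrix (Fin n) (Fin n) ℝ}
    (hQ1 : ∀ j, Q j j = 1) {z g : Fin N → Fin n → ℝ} {r δ : ℝ} (hδ : δ ≤ 1)
    (hg : EntryNear (gram g) Q r) (hz : EntryNear (gram z) Δ δ) (hr0 : 0 < r) (hδ0 : 0 < δ) :
    |(∑ j, inner ℝ (sphereColumns g j) (column z j)) -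
      (tiltExponent A z g + N * boundFunctional Q Δ A)| ≤ N * (comparisonConst Δ A * (r + δ)) := by
  have hN' : (0 : ℝ) < N := by exact_mod_cast hN
  have hsN : (0 : ℝ) < √N := Real.sqrt_pos.mpr hN'
  have hzcol := norm_column_le_of_entryNear hN hδ hz
  have hS : 0 ≤ ∑ j, √(|Δ j j| + 1) := Finset.sum_nonneg fun _ _ => Real.sqrt_nonneg _
  have h1 : |(∑ j, inner ℝ (sphereColumns g j) (column z j)) -
      ∑ j, inner ℝ (column g j) (column z j)| ≤ N * (r * ∑ j, √(|Δ j j| + 1)) := by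
    rw [← Finset.sum_sub_distrib, Finset.mul_sum, Finset.mul_sum]
    refine (Finset.abs_sum_le_sum_abs _ _).trans (Finset.sum_le_sum fun j _ => ?_)
    rw [← inner_sub_left]
    refine (abs_real_inner_le_norm _ _).trans ?_
    have hc : ‖sphereColumns g j - column g j‖ ≤ √N * r := by
      by_cases h0 : column g j = 0
      · rw [sphereColumns, toSphereRadius, h0]; simp; positivity
      have hn := norm_ne_zero_iff.mpr h0
      have : sphereColumns g j - column g j = (1 - ‖column g j‖ / √N) • sphereColumns g j := by
        rw [sub_smul, one_smul]
        congr 1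
        rw [sphereColumns, toSphereRadius, smul_smul]
        field_simp
        simp
      rw [this, norm_smul, norm_sphereColumns g h0, Real.norm_eq_abs, abs_sub_comm, mul_comm]
      gcongr
      refine (abs_norm_column_div_sub_one_le hN g j).trans ?_
      rw [← hQ1 j]
      exact (hg j j).le
    calc _ ≤ √N * r * (√N * √(|Δ j j| + 1)) := by gcongr; exact hzcol j
      _ = (√N * √N) * (r * √(|Δ j j| + 1)) := by ring
      _ = _ := by rw [Real.mul_self_sqrt hN'.le]
  have h2 : |(gram g).trace - n| ≤ n * r := by
    have : (n : ℝ) = ∑ j : Fin n, Q j j := by simp [hQ1]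
    rw [trace]
    simp only [diag]
    conv_lhs => rw [this]
    rw [← Finset.sum_sub_distrib]
    refine (Finset.abs_sum_le_sum_abs _ _).trans
      ((Finset.sum_le_sum fun j _ => (hg j j).le).trans ?_)
    simp
  have h3 := abs_trace_mul_sub_le A hg
  have h4 := abs_trace_mul_sub_le A⁻¹ hz
  have hA0 := entrySum_nonneg A
  have hA1 := entrySum_nonneg A⁻¹
  set S := ∑ j, √(|Δ j j| + 1)
  have e : (∑ j, inner ℝ (sphereColumns g j) (column z j)) -
      (tiltExponent A z g + N * boundFunctional Q Δ A) =
      ((∑ j, inner ℝ (sphereColumns g j) (column z j)) -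
        ∑ j, inner ℝ (column g j) (column z j)) -
      N / 2 * (((gram g).trace - n) - ((A * gram g).trace - (A * Q).trace) -
        ((A⁻¹ * gram z).trace - (A⁻¹ * Δ).trace)) := by
    rw [tiltExponent, boundFunctional]; ring
  rw [e]
  refine (abs_sub _ _).trans ?_
  rw [abs_mul, abs_of_pos (half_pos hN')]
  have h5 := abs_sub (((gram g).trace - n) - ((A * gram g).trace - (A * Q).trace))
    ((A⁻¹ * gram z).trace - (A⁻¹ * Δ).trace)
  have h6 := abs_sub ((gram g).trace - (n : ℝ)) ((A * gram g).trace - (A * Q).trace)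
  have h7 : |((gram g).trace - n) - ((A * gram g).trace - (A * Q).trace) -
        ((A⁻¹ * gram z).trace - (A⁻¹ * Δ).trace)| ≤
        n * r + entrySum A * r + entrySum A⁻¹ * δ := by linarith
  calc _ ≤ N * (r * S) + N / 2 * (n * r + entrySum A * r + entrySum A⁻¹ * δ) :=
        add_le_add h1 (by gcongr)
    _ ≤ N * (r * S) + N * (n * r + entrySum A * r + entrySum A⁻¹ * δ) := by
        gcongr; linarith
    _ = N * (r * S + (n * r + entrySum A * r + entrySum A⁻¹ * δ)) := by ring
    _ ≤ _ := by
        gcongr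
        rw [comparisonConst]
        have : 0 ≤ (n : ℝ) * δ + entrySum A * δ + entrySum A⁻¹ * r + S * δ := by positivity
        nlinarith

/-! ### The upper bound -/

/-- Makes products of two L⁴ functions square integrable, so that the law of large numbers applies
to products of Gaussian coordinates. -/
instance holderTriple_four_four_two : ENNReal.HolderTriple 4 4 2 := ⟨by
  rw [← two_mul, show (4 : ENNReal) = 2 * 2 by norm_num, ENNReal.mul_inv (by simp) (by simp),
    ← mul_assoc, ENNReal.mul_inv_cancel (by simp) (by simp), one_mul]⟩

lemma memLp_sq_gaussianReal : MemLp (fun x : ℝ => x ^ 2) 2 (gaussianReal 0 1) := by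
  have h : MemLp id 4 (gaussianReal 0 1) := memLp_id_gaussianReal' 4 (by simp)
  have := h.mul' h (r := 2)
  simpa [pow_two] using this

lemma integral_sq_gaussianReal : ∫ x, x ^ 2 ∂gaussianReal 0 1 = 1 := by
  have h := variance_id_gaussianReal (μ := 0) (v := 1)
  rw [variance_of_integral_eq_zero (by fun_prop) (by simp)] at h
  simpa using h

lemma tendsto_measure_shell {κ : ℝ} (hκ : 0 < κ) :
    Tendsto (fun N : ℕ => ((gaussianVec N).map (WithLp.toLp 2))
      {x : EuclideanSpace ℝ (Fin N) | ‖x‖ ∈ {r : ℝ | |r / √N - 1| ≤ κ}}) atTop (𝓝 1) := by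
  have h := tendsto_measure_pi_average (gaussianReal 0 1) memLp_sq_gaussianReal hκ
  rw [integral_sq_gaussianReal] at h
  have h1 : Tendsto (fun N : ℕ => 1 - (Measure.pi fun _ : Fin N => gaussianReal 0 1)
      {ω | κ ≤ |(∑ i, ω i ^ 2) / N - 1|}) atTop (𝓝 1) := by
    simpa using ENNReal.Tendsto.sub tendsto_const_nhds h (Or.inl ENNReal.one_ne_top)
  refine tendsto_of_tendsto_of_tendsto_of_le_of_le' h1 tendsto_const_nhds ?_
    (Eventually.of_forall fun N => prob_le_one)
  filter_upwards [eventually_gt_atTop 0] with N hN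
  have hI : MeasurableSet {x : EuclideanSpace ℝ (Fin N) | |‖x‖ / √N - 1| ≤ κ} :=
    measurableSet_le (by fun_prop) measurable_const
  rw [Measure.map_apply (by fun_prop) hI, tsub_le_iff_right,
    ← measure_univ (μ := gaussianVec N)]
  refine (measure_mono ?_).trans (measure_union_le _ _)
  intro ω _
  by_cases hω : κ ≤ |(∑ i, ω i ^ 2) / N - 1|
  · exact Or.inr hω
  · refine Or.inl ?_
    simp only [Set.mem_preimage, Set.mem_ofPred_eq]
    -- The vector is viewed as an array with a single column.
    have h2 := abs_norm_column_div_sub_one_le hN (fun i (_ : Fin 1) => ω i) 0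
    refine h2.trans (le_trans (le_of_eq ?_) (not_le.mp hω).le)
    simp [gram, pow_two]

/-- The spherical integral, times the Gaussian mass of a thin shell, is a Gaussian integral over
arrays with Gram matrix near `Q`. There the integrand is at most exp N(`boundFunctional` + η/2)
times the tilting density, whose total integral is 1. -/
lemma eventually_partitionFn_le {n : ℕ} {Q Δ A : Matrix (Fin n) (Fin n) ℝ}
    (hQ1 : ∀ j, Q j j = 1) (hA : A.PosDef) {η : ℝ} (hη : 0 < η) :
    ∃ κ > 0, ∀ᶠ N : ℕ in atTop, ∀ z : Fin N → Fin n → ℝ, EntryNear (gram z) Δ κ →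
      partitionFn N Q κ z ≤ ENNReal.ofReal (Real.exp (N * (boundFunctional Q Δ A + η))) := by
  set K := comparisonConst Δ A
  have hK : 0 ≤ K := comparisonConst_nonneg Δ A
  -- The Gram matrix is within 3κ (rescaling) plus κ (overlap box) of `Q`, hence strictly within 5κ;
  -- with the error κ of the field the total is 6Kκ ≤ η/2.
  set κ := min (1 / 2) (η / (12 * (K + 1)))
  have hκ0 : 0 < κ := by positivity
  have hκ1 : κ ≤ 1 / 2 := min_le_left _ _
  have hκη : K * (5 * κ + κ) ≤ η / 2 := by
    have : κ ≤ η / (12 * (K + 1)) := min_le_right _ _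
    rw [le_div_iff₀ (by positivity)] at this
    nlinarith
  refine ⟨κ, hκ0, ?_⟩
  -- The other half of η pays for dividing by the shell mass, which is eventually at least 1/2 for
  -- each of the n columns.
  have hexp : ∀ᶠ N : ℕ in atTop, Real.exp (-(N * (η / 2))) ≤ (1 / 2) ^ n := by
    have : Tendsto (fun N : ℕ => Real.exp (-(N * (η / 2)))) atTop (𝓝 0) :=
      Real.tendsto_exp_neg_atTop_nhds_zero.comp
        (tendsto_natCast_atTop_atTop.atTop_mul_const (by positivity))
    exact this.eventually_le_const (by positivity)
  have hshell := (tendsto_measure_shell hκ0).eventually_const_le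
    (u := 2⁻¹) (by simp)
  filter_upwards [hexp, hshell, eventually_gt_atTop 0] with N hN1 hN2 hN z hz
  set I := {r : ℝ | |r / √N - 1| ≤ κ}
  have hI : MeasurableSet I := measurableSet_le (by fun_prop) measurable_const
  set c := ((gaussianVec N).map (WithLp.toLp 2)) {x : EuclideanSpace ℝ (Fin N) | ‖x‖ ∈ I}
  set b := boundFunctional Q Δ A
  have hle : c ^ n * partitionFn N Q κ z ≤ ENNReal.ofReal (Real.exp (N * (b + η / 2))) := by
    rw [lintegral_sphereColumns hN hI]
    calc _ ≤ ∫⁻ g in {g | (∀ j, ‖column g j‖ ∈ I) ∧ sphereColumns g ∈ overlapSet N Q κ},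
          ENNReal.ofReal (Real.exp (N * (b + η / 2))) *
            ENNReal.ofReal (Real.exp (tiltExponent A z g)) ∂gaussianArray N n := by
          refine setLIntegral_mono' ?_ fun g hg => ?_
          · refine MeasurableSet.inter (s₁ := {g : Fin N → Fin n → ℝ | ∀ j, ‖column g j‖ ∈ I}) ?_
              (measurable_sphereColumns (isClosed_overlapSet N Q κ).measurableSet)
            simp only [Set.ofPred_forall]
            exact MeasurableSet.iInter fun j => (measurable_column j).norm hI
          · obtain ⟨hg1, hg2⟩ := hg
            rw [← ENNReal.ofReal_mul (Real.exp_pos _).le, ← Real.exp_add]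
            gcongr
            have hnear : EntryNear (gram g) Q (5 * κ) := by
              intro j k
              have h1 := abs_gram_sub_overlap_le hN (by linarith) g hg1 j k
              have h2 := hg2.2 j k
              have h3 : |overlap (sphereColumns g j) (sphereColumns g k) - Q j k| ≤ κ := by
                rw [abs_le]; constructor <;> linarith [h2.1, h2.2]
              linarith [abs_sub_le (gram g j k) (overlap (sphereColumns g j) (sphereColumns g k))
                (Q j k)]
            have := (abs_le.mp (abs_exponent_sub_tilt_le (A := A) hN hQ1 (by linarith) hnear hz
              (by positivity) hκ0)).2
            have h4 : (N : ℝ) * (K * (5 * κ + κ)) ≤ N * (η / 2) := by gcongr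
            linarith
      _ ≤ ∫⁻ g, ENNReal.ofReal (Real.exp (N * (b + η / 2))) *
            ENNReal.ofReal (Real.exp (tiltExponent A z g)) ∂gaussianArray N n :=
          setLIntegral_le_lintegral _ _
      _ = _ := by
          rw [lintegral_const_mul' _ _ ENNReal.ofReal_ne_top, lintegral_tilt hN hA, mul_one]
  have hc : ENNReal.ofReal (Real.exp (-(N * (η / 2)))) ≤ c ^ n := by
    calc _ ≤ ENNReal.ofReal ((1 / 2) ^ n) := ENNReal.ofReal_le_ofReal hN1
      _ = (2⁻¹ : ENNReal) ^ n := by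
        rw [ENNReal.ofReal_pow (by norm_num)]
        congr 1
        rw [one_div, ENNReal.ofReal_inv_of_pos (by norm_num)]; simp
      _ ≤ _ := by gcongr; exact hN2
  have h5 := (mul_le_mul_left hc (partitionFn N Q κ z)).trans hle
  have h6 : ENNReal.ofReal (Real.exp (N * (η / 2))) * ENNReal.ofReal (Real.exp (-(N * (η / 2)))) =
      1 := by
    rw [← ENNReal.ofReal_mul (Real.exp_pos _).le, ← Real.exp_add]; simp
  calc partitionFn N Q κ z = ENNReal.ofReal (Real.exp (N * (η / 2))) *
        (ENNReal.ofReal (Real.exp (-(N * (η / 2)))) * partitionFn N Q κ z) := by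
        rw [← mul_assoc, h6, one_mul]
    _ ≤ ENNReal.ofReal (Real.exp (N * (η / 2))) * ENNReal.ofReal (Real.exp (N * (b + η / 2))) := by
        gcongr
    _ = _ := by
        rw [← ENNReal.ofReal_mul (Real.exp_pos _).le, ← Real.exp_add]
        congr 2; ring

/-! ### The lower bound for a fixed field -/

/-- The integral is restricted to arrays with Gram matrix within κ of `Q`, where the integrand is
bounded below by the tilting density; what remains is the tilted probability of that event. Its
rescaled columns lie in the box of half-width `r`, because the overlaps are off by at most 3κ + κ.
-/
lemma le_partitionFn {N n : ℕ} (hN : 0 < N) {Q Δ A B : Matrix (Fin n) (Fin n) ℝ}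
    (hQ1 : ∀ j, Q j j = 1) (hA : A.PosDef) (hBt : Bᵀ = B) (hB : B * B = A⁻¹) {r κ η : ℝ}
    (hκ0 : 0 < κ) (hκ1 : κ ≤ 1 / 2) (hκr : 4 * κ ≤ r) (hκη : comparisonConst Δ A * (κ + κ) ≤ η)
    {z : Fin N → Fin n → ℝ} (hz : EntryNear (gram z) Δ κ) :
    ENNReal.ofReal (Real.exp (N * (boundFunctional Q Δ A - η))) *
      gaussianArray N n {g | EntryNear (gram fun i => A⁻¹ *ᵥ z i + B *ᵥ g i) Q κ} ≤
      partitionFn N Q r z := by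
  set b := boundFunctional Q Δ A
  have hm : Measurable fun (g : Fin N → Fin n → ℝ) i => A⁻¹ *ᵥ z i + B *ᵥ g i := by
    unfold mulVec dotProduct; fun_prop
  have hS : MeasurableSet {g : Fin N → Fin n → ℝ | EntryNear (gram g) Q κ} := by
    simp only [EntryNear, Set.ofPred_forall]
    refine MeasurableSet.iInter fun j => MeasurableSet.iInter fun k =>
      measurableSet_lt ?_ measurable_const
    simp only [gram, of_apply]
    fun_prop
  -- Without a constraint on the norms the Gaussian mass factor is 1.
  have hp := lintegral_sphereColumns hN MeasurableSet.univ Q r z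
  simp only [Set.mem_univ, Set.ofPred_true, measure_univ, one_pow, one_mul, implies_true,
    true_and] at hp
  have hmap : gaussianArray N n {g | EntryNear (gram fun i => A⁻¹ *ᵥ z i + B *ᵥ g i) Q κ} =
      ∫⁻ g in {g | EntryNear (gram g) Q κ}, ENNReal.ofReal (Real.exp (tiltExponent A z g))
        ∂gaussianArray N n := by
    rw [← withDensity_apply _ hS, ← gaussianArray_map_tilt hN hA hBt hB z,
      Measure.map_apply hm hS]
    rfl
  rw [hp, hmap, ← lintegral_const_mul' _ _ ENNReal.ofReal_ne_top]
  have hnear {g : Fin N → Fin n → ℝ} (hg : EntryNear (gram g) Q κ) (j : Fin n) :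
      |‖column g j‖ / √N - 1| ≤ κ := by
    refine (abs_norm_column_div_sub_one_le hN g j).trans ?_
    rw [← hQ1 j]
    exact (hg j j).le
  have hsub : {g : Fin N → Fin n → ℝ | EntryNear (gram g) Q κ} ⊆
      {g | sphereColumns g ∈ overlapSet N Q r} := by
    intro g hg
    refine ⟨fun j => ?_, fun j k => ?_⟩
    · rw [mem_sphere_zero_iff_norm]
      refine norm_sphereColumns g fun h0 => ?_
      have := hnear hg j
      rw [h0] at this
      norm_num at this
      linarith
    · have h1 := abs_le.mp (abs_gram_sub_overlap_le hN (by linarith) g (hnear hg) j k)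
      have h2 := abs_lt.mp (hg j k)
      constructor <;> linarith [h1.1, h1.2, h2.1, h2.2]
  refine le_trans ?_ (lintegral_mono_set hsub)
  refine setLIntegral_mono' hS fun g hg => ?_
  rw [← ENNReal.ofReal_mul (Real.exp_pos _).le, ← Real.exp_add]
  gcongr
  have h1 := (abs_le.mp (abs_exponent_sub_tilt_le (A := A) hN hQ1 (by linarith) hg hz hκ0 hκ0)).1
  have h2 : (N : ℝ) * (comparisonConst Δ A * (κ + κ)) ≤ N * η := by gcongr
  linarith

/-! ### Second moments -/

section Moments

variable {n : ℕ} {Ω : Type*} [MeasurableSpace Ω] {μ : Measure Ω}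

lemma memLp_mulVec {X : Ω → Fin n → ℝ} {p : ENNReal} (hX : ∀ j, MemLp (fun ω => X ω j) p μ)
    (C : Matrix (Fin n) (Fin n) ℝ) (j : Fin n) : MemLp (fun ω => (C *ᵥ X ω) j) p μ := by
  simp only [mulVec, dotProduct]
  exact memLp_finsetSum _ fun k _ => (hX k).const_mul _

lemma integral_mulVec_mul_mulVec {X : Ω → Fin n → ℝ} {M : Matrix (Fin n) (Fin n) ℝ}
    (hX : ∀ j k, Integrable (fun ω => X ω j * X ω k) μ)
    (hM : ∀ j k, ∫ ω, X ω j * X ω k ∂μ = M j k) (C : Matrix (Fin n) (Fin n) ℝ) (j k : Fin n) :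
    ∫ ω, (C *ᵥ X ω) j * (C *ᵥ X ω) k ∂μ = (C * M * Cᵀ) j k := by
  have e (ω : Ω) : (C *ᵥ X ω) j * (C *ᵥ X ω) k =
      ∑ b, ∑ a, C j a * C k b * (X ω a * X ω b) := by
    simp only [mulVec, dotProduct, Finset.sum_mul_sum]
    rw [Finset.sum_comm]
    exact Finset.sum_congr rfl fun _ _ => Finset.sum_congr rfl fun _ _ => by ring
  simp only [e]
  rw [integral_finsetSum _ fun b _ => integrable_finsetSum _ fun a _ => (hX a b).const_mul _]
  simp only [mul_apply, transpose_apply]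
  refine Finset.sum_congr rfl fun b _ => ?_
  rw [integral_finsetSum _ fun a _ => (hX a b).const_mul _, Finset.sum_mul]
  refine Finset.sum_congr rfl fun a _ => ?_
  rw [integral_const_mul, hM]
  ring

lemma integral_mulVec_eq_zero {X : Ω → Fin n → ℝ} (hX : ∀ j, Integrable (fun ω => X ω j) μ)
    (h0 : ∀ j, ∫ ω, X ω j ∂μ = 0) (C : Matrix (Fin n) (Fin n) ℝ) (j : Fin n) :
    ∫ ω, (C *ᵥ X ω) j ∂μ = 0 := by
  simp only [mulVec, dotProduct]
  rw [integral_finsetSum _ fun k _ => (hX k).const_mul _]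
  simp [integral_const_mul, h0]

end Moments

section Gaussian

variable {n : ℕ}

lemma memLp_gaussianVec (j : Fin n) {p : ENNReal} (hp : p ≠ ⊤) :
    MemLp (fun y : Fin n → ℝ => y j) p (gaussianVec n) :=
  (memLp_id_gaussianReal' p hp).comp_measurePreserving
    (measurePreserving_eval (fun _ : Fin n => gaussianReal 0 1) j)

lemma integral_gaussianVec_eval (j : Fin n) : ∫ y, y j ∂gaussianVec n = 0 := by
  have h := integral_comp_eval (μ := fun _ : Fin n => gaussianReal 0 1) (i := j)
    (f := fun x : ℝ => x) (by fun_prop)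
  exact h.trans integral_id_gaussianReal

lemma integral_gaussianVec_mul (j k : Fin n) :
    ∫ y, y j * y k ∂gaussianVec n = (1 : Matrix (Fin n) (Fin n) ℝ) j k := by
  by_cases hjk : j = k
  · subst hjk
    have h := integral_comp_eval (μ := fun _ : Fin n => gaussianReal 0 1) (i := j)
      (f := fun x : ℝ => x ^ 2) (by fun_prop)
    simp only [integral_sq_gaussianReal] at h
    simp only [pow_two] at h
    rw [Matrix.one_apply_eq]
    exact h
  · have hind : IndepFun (fun y : Fin n → ℝ => y j) (fun y => y k) (gaussianVec n) :=
      (iIndepFun_pi (μ := fun _ : Fin n => gaussianReal 0 1) (X := fun _ x => x)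
        fun _ => aemeasurable_id).indepFun hjk
    rw [hind.integral_fun_mul_eq_mul_integral
      (measurable_pi_apply j).aestronglyMeasurable (measurable_pi_apply k).aestronglyMeasurable,
      integral_gaussianVec_eval]
    simp [Matrix.one_apply_ne hjk]

variable (Δ : Matrix (Fin n) (Fin n) ℝ)

lemma memLp_multivariateGaussian (j : Fin n) {p : ENNReal} (hp : p ≠ ⊤) :
    MemLp (fun z : EuclideanSpace ℝ (Fin n) => z j) p (multivariateGaussian 0 Δ) := by
  refine (IsGaussian.memLp_id (multivariateGaussian 0 Δ) p hp).of_le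
    (by fun_prop) (Eventually.of_forall fun z => ?_)
  exact PiLp.norm_apply_le z j

lemma integral_multivariateGaussian_eval (j : Fin n) :
    ∫ z : EuclideanSpace ℝ (Fin n), z j ∂multivariateGaussian 0 Δ = 0 := by
  have h := (EuclideanSpace.proj (𝕜 := ℝ) j).integral_comp_comm
    (IsGaussian.integrable_id (μ := multivariateGaussian (0 : EuclideanSpace ℝ (Fin n)) Δ))
  simpa using h

lemma integral_multivariateGaussian_mul {Δ : Matrix (Fin n) (Fin n) ℝ} (hΔ : Δ.PosSemidef)
    (j k : Fin n) :
    ∫ z : EuclideanSpace ℝ (Fin n), z j * z k ∂multivariateGaussian 0 Δ = Δ j k := by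
  rw [← covariance_eval_multivariateGaussian (μ := 0) hΔ j k,
    covariance_eq_sub (memLp_multivariateGaussian Δ j (by simp))
      (memLp_multivariateGaussian Δ k (by simp)), integral_multivariateGaussian_eval]
  simp

end Gaussian

/-! ### The lower bound in probability -/

instance {n : ℕ} (N : ℕ) (Δ : Matrix (Fin n) (Fin n) ℝ) : IsProbabilityMeasure (fieldLaw N Δ) := by
  unfold fieldLaw; infer_instance

/-- The underlying real array of a realization of the external field. -/
def fieldArray {N n : ℕ} (z : Fin N → EuclideanSpace ℝ (Fin n)) : Fin N → Fin n → ℝ :=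
  fun i j => z i j

lemma tendsto_fieldLaw_gram {n : ℕ} {Δ : Matrix (Fin n) (Fin n) ℝ} (hΔ : Δ.PosSemidef)
    {δ : ℝ} (hδ : 0 < δ) :
    Tendsto (fun N : ℕ => fieldLaw N Δ {z | ¬ EntryNear (gram (fieldArray z)) Δ δ})
      atTop (𝓝 0) :=
  tendsto_measure_gram (multivariateGaussian 0 Δ) (f := fun z j => z j)
    (fun j k => (memLp_multivariateGaussian Δ k (p := 4) (by simp)).mul'
      (memLp_multivariateGaussian Δ j (p := 4) (by simp)))
    (fun j k => integral_multivariateGaussian_mul hΔ j k) hδ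

/-- Averaged over the field, the tilted rows are independent and identically distributed. Their
second moments are A⁻¹ΔA⁻¹ + B², the cross terms vanishing by independence and centering. -/
lemma tendsto_fieldLaw_tilted_gram {n : ℕ} {Q Δ A B : Matrix (Fin n) (Fin n) ℝ}
    (hΔ : Δ.PosSemidef) (hBt : Bᵀ = B) (hAt : Aᵀ = A) (hQ : A⁻¹ * Δ * A⁻¹ + B * B = Q)
    {δ : ℝ} (hδ : 0 < δ) :
    Tendsto (fun N : ℕ => ((fieldLaw N Δ).prod (gaussianArray N n))
      {p | ¬ EntryNear (gram fun i => A⁻¹ *ᵥ fieldArray p.1 i + B *ᵥ p.2 i) Q δ})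
      atTop (𝓝 0) := by
  set ν := multivariateGaussian (0 : EuclideanSpace ℝ (Fin n)) Δ
  set μ := ν.prod (gaussianVec n)
  let U : EuclideanSpace ℝ (Fin n) × (Fin n → ℝ) → Fin n → ℝ := fun ω => A⁻¹ *ᵥ fun j => ω.1 j
  let V : EuclideanSpace ℝ (Fin n) × (Fin n → ℝ) → Fin n → ℝ := fun ω => B *ᵥ ω.2
  have hU0 {p : ENNReal} (hp : p ≠ ⊤) (j : Fin n) :
      MemLp (fun z : EuclideanSpace ℝ (Fin n) => (A⁻¹ *ᵥ fun a => z a) j) p ν :=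
    memLp_mulVec (X := fun (z : EuclideanSpace ℝ (Fin n)) a => z a)
      (fun a => memLp_multivariateGaussian Δ a hp) _ j
  have hV0 {p : ENNReal} (hp : p ≠ ⊤) (j : Fin n) :
      MemLp (fun y : Fin n → ℝ => (B *ᵥ y) j) p (gaussianVec n) :=
    memLp_mulVec (X := fun (y : Fin n → ℝ) => y) (fun a => memLp_gaussianVec a hp) _ j
  have hU {p : ENNReal} (hp : p ≠ ⊤) (j : Fin n) : MemLp (fun ω => U ω j) p μ :=
    (hU0 hp j).comp_fst (gaussianVec n)
  have hV {p : ENNReal} (hp : p ≠ ⊤) (j : Fin n) : MemLp (fun ω => V ω j) p μ :=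
    (hV0 hp j).comp_snd ν
  have hmul (X Y : EuclideanSpace ℝ (Fin n) × (Fin n → ℝ) → Fin n → ℝ)
      (hX : ∀ j, MemLp (fun ω => X ω j) 4 μ) (hY : ∀ j, MemLp (fun ω => Y ω j) 4 μ) (j k : Fin n) :
      MemLp (fun ω => X ω j * Y ω k) 2 μ := (hY k).mul' (hX j)
  have hcov (j k : Fin n) : ∫ ω, (U + V) ω j * (U + V) ω k ∂μ = Q j k := by
    have hU4 := fun j => hU (p := 4) (by simp) j
    have hV4 := fun j => hV (p := 4) (by simp) j
    have i1 := (hmul U U hU4 hU4 j k).integrable one_le_two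
    have i2 := (hmul U V hU4 hV4 j k).integrable one_le_two
    have i3 := (hmul V U hV4 hU4 j k).integrable one_le_two
    have i4 := (hmul V V hV4 hV4 j k).integrable one_le_two
    have e (ω) : (U + V) ω j * (U + V) ω k =
        U ω j * U ω k + U ω j * V ω k + (V ω j * U ω k + V ω j * V ω k) := by
      simp only [Pi.add_apply]; ring
    have hV1 (j : Fin n) : ∫ y, (B *ᵥ y) j ∂gaussianVec n = 0 :=
      integral_mulVec_eq_zero (X := fun y => y)
        (fun a => (memLp_gaussianVec a (p := 1) (by simp)).integrable le_rfl)
        integral_gaussianVec_eval B j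
    have e1 : ∫ ω, U ω j * U ω k ∂μ = (A⁻¹ * Δ * A⁻¹ᵀ) j k := by
      rw [← integral_mulVec_mul_mulVec (μ := ν) (X := fun (z : EuclideanSpace ℝ (Fin n)) a => z a)
        (fun a b => ((memLp_multivariateGaussian Δ b (p := 4) (by simp)).mul'
          (memLp_multivariateGaussian Δ a (p := 4) (by simp)) (r := 2)).integrable one_le_two)
        (fun a b => integral_multivariateGaussian_mul hΔ a b)]
      have := integral_fun_fst (μ := ν) (ν := gaussianVec n)
        (fun z => (A⁻¹ *ᵥ fun a => z a) j * (A⁻¹ *ᵥ fun a => z a) k)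
      simpa using this
    have e4 : ∫ ω, V ω j * V ω k ∂μ = (B * (1 : Matrix (Fin n) (Fin n) ℝ) * Bᵀ) j k := by
      rw [← integral_mulVec_mul_mulVec (μ := gaussianVec n) (X := fun (y : Fin n → ℝ) => y)
        (fun a b => ((memLp_gaussianVec b (p := 4) (by simp)).mul'
          (memLp_gaussianVec a (p := 4) (by simp)) (r := 2)).integrable one_le_two)
        (fun a b => integral_gaussianVec_mul a b)]
      have := integral_fun_snd (μ := ν) (ν := gaussianVec n)
        (fun y => (B *ᵥ y) j * (B *ᵥ y) k)
      simpa using this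
    have e2 : ∫ ω, U ω j * V ω k ∂μ = 0 := by
      have := integral_prod_mul (μ := ν) (ν := gaussianVec n)
        (fun z : EuclideanSpace ℝ (Fin n) => (A⁻¹ *ᵥ fun a => z a) j) (fun y => (B *ᵥ y) k)
      rw [hV1, mul_zero] at this
      exact this
    have e3 : ∫ ω, V ω j * U ω k ∂μ = 0 := by
      have := integral_prod_mul (μ := ν) (ν := gaussianVec n)
        (fun z : EuclideanSpace ℝ (Fin n) => (A⁻¹ *ᵥ fun a => z a) k) (fun y => (B *ᵥ y) j)
      rw [hV1, mul_zero] at this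
      simp only [mul_comm (V _ j)]
      exact this
    simp only [e]
    have i12 : Integrable (fun ω => U ω j * U ω k + U ω j * V ω k) μ := i1.add i2
    have i34 : Integrable (fun ω => V ω j * U ω k + V ω j * V ω k) μ := i3.add i4
    rw [integral_add i12 i34, integral_add i1 i2, integral_add i3 i4, e1, e2, e3,
      e4, ← hQ, transpose_nonsing_inv, hAt, hBt]
    simp
  have h := tendsto_measure_gram μ (f := U + V) (fun j k => hmul (U + V) (U + V)
    (fun j => (hU (by simp) j).add (hV (by simp) j))
    (fun j => (hU (by simp) j).add (hV (by simp) j)) j k) hcov hδ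
  refine h.congr fun N => ?_
  -- An array of N independent pairs is a pair of independent arrays.
  have hmp := measurePreserving_arrowProdEquivProdArrow (EuclideanSpace ℝ (Fin n)) (Fin n → ℝ)
    (Fin N) (fun _ => ν) (fun _ => gaussianVec n)
  change _ = ((Measure.pi fun _ : Fin N => ν).prod (Measure.pi fun _ : Fin N => gaussianVec n)) _
  rw [← hmp.measure_preimage_equiv]
  rfl

lemma measurableSet_not_entryNear {n N : ℕ} (A B Q : Matrix (Fin n) (Fin n) ℝ) (δ : ℝ) :
    MeasurableSet {p : (Fin N → EuclideanSpace ℝ (Fin n)) × (Fin N → Fin n → ℝ) |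
      ¬ EntryNear (gram fun i => A *ᵥ fieldArray p.1 i + B *ᵥ p.2 i) Q δ} := by
  have : MeasurableSet {p : (Fin N → EuclideanSpace ℝ (Fin n)) × (Fin N → Fin n → ℝ) |
      EntryNear (gram fun i => A *ᵥ fieldArray p.1 i + B *ᵥ p.2 i) Q δ} := by
    simp only [EntryNear, Set.ofPred_forall]
    refine MeasurableSet.iInter fun j => MeasurableSet.iInter fun k =>
      measurableSet_lt ?_ measurable_const
    simp only [gram, of_apply, fieldArray, mulVec, dotProduct, Pi.add_apply]
    fun_prop
  exact this.compl

/-- Multiplied by A⁻¹ on both sides, the critical equation reads Q = A⁻¹ΔA⁻¹ + A⁻¹, so the tilted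
Gram matrix concentrates at `Q` under the joint law. For most fields the conditional probability of
concentration is then at least 1/2, and `le_partitionFn` applies. -/
lemma tendsto_fieldLaw_partitionFn_lt {n : ℕ} {Q Δ A : Matrix (Fin n) (Fin n) ℝ}
    (hQ1 : ∀ j, Q j j = 1) (hΔ : Δ.PosSemidef) (hA : A.PosDef) (hcrit : A * Q * A = A + Δ)
    {r η : ℝ} (hr : 0 < r) (hη : 0 < η) :
    Tendsto (fun N : ℕ => fieldLaw N Δ {z | partitionFn N Q r (fieldArray z) <
      ENNReal.ofReal (Real.exp (N * (boundFunctional Q Δ A - η)))}) atTop (𝓝 0) := by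
  obtain ⟨B, hBt, hB⟩ := exists_sqrt_inv hA
  have hAt : Aᵀ = A := by simpa [Matrix.IsHermitian] using hA.1
  have hAu : IsUnit A.det := isUnit_iff_ne_zero.mpr hA.det_pos.ne'
  have hQ : A⁻¹ * Δ * A⁻¹ + B * B = Q := by
    have h1 : Δ = A * Q * A - A := by rw [hcrit]; simp
    rw [hB, h1, mul_sub, sub_mul, nonsing_inv_mul _ hAu, one_mul, mul_assoc A Q A,
      nonsing_inv_mul_cancel_left _ _ hAu, mul_nonsing_inv_cancel_right _ _ hAu]
    simp
  set K := comparisonConst Δ A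
  have hK : 0 ≤ K := comparisonConst_nonneg Δ A
  -- The comparison error 2Kκ takes half of η; the other half absorbs the factor 1/2 from the tilted
  -- probability.
  set κ := min (min (1 / 2) (r / 4)) (η / (4 * (K + 1)))
  have hκ0 : 0 < κ := by positivity
  have hκ1 : κ ≤ 1 / 2 := (min_le_left _ _).trans (min_le_left _ _)
  have hκr : 4 * κ ≤ r := by
    have : κ ≤ r / 4 := (min_le_left _ _).trans (min_le_right _ _)
    linarith
  have hκη : K * (κ + κ) ≤ η / 2 := by
    have : κ ≤ η / (4 * (K + 1)) := min_le_right _ _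
    rw [le_div_iff₀ (by positivity)] at this
    nlinarith
  have t1 := tendsto_fieldLaw_gram hΔ hκ0
  have t2 := (tendsto_fieldLaw_tilted_gram hΔ hBt hAt hQ hκ0)
  have t3 := t1.add (ENNReal.Tendsto.const_mul (a := 2) t2 (Or.inr (by simp)))
  simp only [mul_zero, add_zero] at t3
  have hexp : ∀ᶠ N : ℕ in atTop, Real.exp (-(N * (η / 2))) < 1 / 2 := by
    have : Tendsto (fun N : ℕ => Real.exp (-(N * (η / 2)))) atTop (𝓝 0) :=
      Real.tendsto_exp_neg_atTop_nhds_zero.comp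
        (tendsto_natCast_atTop_atTop.atTop_mul_const (by positivity))
    exact this.eventually_lt_const (by positivity)
  refine tendsto_of_tendsto_of_tendsto_of_le_of_le' tendsto_const_nhds t3
    (Eventually.of_forall fun _ => zero_le) ?_
  filter_upwards [hexp, eventually_gt_atTop 0] with N hN1 hN
  set bad := {p : (Fin N → EuclideanSpace ℝ (Fin n)) × (Fin N → Fin n → ℝ) |
    ¬ EntryNear (gram fun i => A⁻¹ *ᵥ fieldArray p.1 i + B *ᵥ p.2 i) Q κ}
  have hbad : MeasurableSet bad := measurableSet_not_entryNear _ _ _ _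
  set P := fun z => gaussianArray N n (Prod.mk z ⁻¹' bad)
  have hP : Measurable P := measurable_measure_prodMk_left hbad
  -- Markov's inequality for the conditional probability of the bad event given the field.
  have hmarkov : fieldLaw N Δ {z | 2⁻¹ ≤ P z} ≤ 2 * ((fieldLaw N Δ).prod (gaussianArray N n)) bad := by
    rw [Measure.prod_apply hbad]
    have h := mul_meas_ge_le_lintegral hP 2⁻¹ (μ := fieldLaw N Δ)
    calc _ = 2 * (2⁻¹ * fieldLaw N Δ {z | 2⁻¹ ≤ P z}) := by
          rw [← mul_assoc, ENNReal.mul_inv_cancel (by simp) (by simp), one_mul]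
      _ ≤ _ := by gcongr
  refine (measure_mono ?_).trans ((measure_union_le _ _).trans (add_le_add_right hmarkov _))
  intro z hz
  by_contra hcon
  simp only [Set.mem_union, Set.mem_ofPred_eq, not_or, not_not, not_le] at hcon
  obtain ⟨h1, h2⟩ := hcon
  rw [Set.mem_ofPred_eq] at hz
  refine absurd hz (not_lt.mpr ?_)
  refine le_trans ?_ (le_partitionFn hN hQ1 hA hBt hB hκ0 hκ1 hκr hκη h1)
  have hgood : (2⁻¹ : ENNReal) ≤ gaussianArray N n
      {g | EntryNear (gram fun i => A⁻¹ *ᵥ fieldArray z i + B *ᵥ g i) Q κ} := by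
    have hm : MeasurableSet (Prod.mk z ⁻¹' bad) := measurable_prodMk_left hbad
    have : {g | EntryNear (gram fun i => A⁻¹ *ᵥ fieldArray z i + B *ᵥ g i) Q κ} =
        (Prod.mk z ⁻¹' bad)ᶜ := by
      ext g; simp [bad]
    rw [this, prob_compl_eq_one_sub hm, ← ENNReal.one_sub_inv_two]
    gcongr
  calc ENNReal.ofReal (Real.exp (N * (boundFunctional Q Δ A - η)))
      = ENNReal.ofReal (Real.exp (N * (boundFunctional Q Δ A - η / 2))) *
        ENNReal.ofReal (Real.exp (-(N * (η / 2)))) := by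
        rw [← ENNReal.ofReal_mul (Real.exp_pos _).le, ← Real.exp_add]
        congr 2; ring
    _ ≤ ENNReal.ofReal (Real.exp (N * (boundFunctional Q Δ A - η / 2))) * 2⁻¹ := by
        gcongr
        calc _ ≤ ENNReal.ofReal (1 / 2) := ENNReal.ofReal_le_ofReal hN1.le
          _ = _ := by rw [one_div, ENNReal.ofReal_inv_of_pos (by norm_num)]; simp
    _ ≤ _ := by gcongr

/-! ### The bound functional -/

/-- With S = √Q and A = S⁻¹CS⁻¹ the equation becomes C² = C + SΔS. Completing the square gives the
solution C = 1/2 + √(1/4 + SΔS), which is positive definite. -/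
lemma exists_critical {n : ℕ} {Q Δ : Matrix (Fin n) (Fin n) ℝ} (hQ : Q.PosDef)
    (hΔ : Δ.PosSemidef) : ∃ A : Matrix (Fin n) (Fin n) ℝ, A.PosDef ∧ A * Q * A = A + Δ := by
  open scoped MatrixOrder in
  have hS0 := (CFC.sqrt_nonneg Q).posSemidef
  have hSS : CFC.sqrt Q * CFC.sqrt Q = Q := CFC.sqrt_mul_sqrt_self _ hQ.posSemidef.nonneg
  generalize CFC.sqrt Q = S at hS0 hSS
  have hSdet : S.det ≠ 0 := by
    intro h
    have h1 := congrArg Matrix.det hSS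
    rw [det_mul, h, zero_mul] at h1
    exact hQ.det_pos.ne h1
  have hSu : IsUnit S.det := isUnit_iff_ne_zero.mpr hSdet
  have hSH : Sᴴ = S := hS0.1
  have hD : ((1 / 4 : ℝ) • (1 : Matrix (Fin n) (Fin n) ℝ) + S * Δ * S).PosSemidef := by
    refine (PosSemidef.one.smul (by norm_num)).add ?_
    have h := hΔ.mul_mul_conjTranspose_same S
    rwa [hSH] at h
  have hT0 := (CFC.sqrt_nonneg ((1 / 4 : ℝ) • (1 : Matrix (Fin n) (Fin n) ℝ) + S * Δ * S)).posSemidef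
  have hTT := CFC.sqrt_mul_sqrt_self _ hD.nonneg
  generalize CFC.sqrt ((1 / 4 : ℝ) • (1 : Matrix (Fin n) (Fin n) ℝ) + S * Δ * S) = T at hT0 hTT
  have hC : ((1 / 2 : ℝ) • (1 : Matrix (Fin n) (Fin n) ℝ) + T).PosDef :=
    (PosDef.one.smul (by norm_num)).add_posSemidef hT0
  have hCC : ((1 / 2 : ℝ) • (1 : Matrix (Fin n) (Fin n) ℝ) + T) *
      ((1 / 2 : ℝ) • (1 : Matrix (Fin n) (Fin n) ℝ) + T) =
      ((1 / 2 : ℝ) • (1 : Matrix (Fin n) (Fin n) ℝ) + T) + S * Δ * S := by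
    rw [add_mul, mul_add, mul_add, hTT]
    simp only [smul_mul_assoc, mul_smul_comm, one_mul, mul_one, smul_smul]
    module
  generalize (1 / 2 : ℝ) • (1 : Matrix (Fin n) (Fin n) ℝ) + T = C at hC hCC
  refine ⟨S⁻¹ * C * S⁻¹, ?_, ?_⟩
  · have hSi : (S⁻¹)ᴴ = S⁻¹ := by rw [conjTranspose_nonsing_inv, hSH]
    have h := hC.conjTranspose_mul_mul_same (B := S⁻¹)
      (mulVec_injective_iff_isUnit.mpr
        ((isUnit_iff_isUnit_det _).mpr (isUnit_nonsing_inv_det _ hSu)))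
    rwa [hSi] at h
  · have h1 : S⁻¹ * C * S⁻¹ * Q * (S⁻¹ * C * S⁻¹) = S⁻¹ * (C * C) * S⁻¹ := by
      rw [← hSS]
      simp only [mul_assoc]
      rw [nonsing_inv_mul_cancel_left _ _ hSu, mul_nonsing_inv_cancel_left _ _ hSu]
    rw [h1, hCC, mul_add, add_mul]
    congr 1
    simp only [mul_assoc]
    rw [nonsing_inv_mul_cancel_left _ _ hSu, mul_nonsing_inv _ hSu, mul_one]

/-- For a null vector v of the quadratic form of `Q`, take A = 1 + t vvᵀ. Then Tr(AQ) does not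
change, Tr(A⁻¹Δ) does not exceed Tr Δ, and log det A = log(1 + t|v|²) is arbitrarily large. -/
lemma exists_boundFunctional_lt_of_not_posDef {n : ℕ} {Q Δ : Matrix (Fin n) (Fin n) ℝ}
    (hQ : Q.PosSemidef) (hQ' : ¬ Q.PosDef) (hΔ : Δ.PosSemidef) (c : ℝ) :
    ∃ A : Matrix (Fin n) (Fin n) ℝ, A.PosDef ∧ boundFunctional Q Δ A < c := by
  obtain ⟨v, hv, hQv⟩ : ∃ v : Fin n → ℝ, v ≠ 0 ∧ v ⬝ᵥ Q *ᵥ v = 0 := by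
    by_contra hcon
    push Not at hcon
    refine hQ' (PosDef.of_dotProduct_mulVec_pos hQ.1 fun v hv => ?_)
    exact lt_of_le_of_ne (hQ.dotProduct_mulVec_nonneg v) (by simpa using (hcon v hv).symm)
  have hvv : 0 < v ⬝ᵥ v := by
    have := dotProduct_star_self_pos_iff.mpr hv
    simpa using this
  have hpsd : (vecMulVec v v).PosSemidef := by
    simpa using posSemidef_vecMulVec_self_star v
  have htr (M : Matrix (Fin n) (Fin n) ℝ) : (vecMulVec v v * M).trace = v ⬝ᵥ M *ᵥ v := by
    rw [vecMulVec_mul, trace_vecMulVec, dotProduct_mulVec, dotProduct_comm]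
  have hΔv : 0 ≤ v ⬝ᵥ Δ *ᵥ v := by simpa using hΔ.dotProduct_mulVec_nonneg v
  -- Once log det A ≥ x, the functional is at most c − 1/2.
  set x := Q.trace + Δ.trace - n - 2 * c + 1
  set t := Real.exp (|x|) / (v ⬝ᵥ v)
  have ht : 0 < t := by positivity
  have htv : t * (v ⬝ᵥ v) = Real.exp |x| := by simp only [t]; field_simp
  have h1t : 0 < 1 + t * (v ⬝ᵥ v) := by positivity
  have hA : (1 + t • vecMulVec v v).PosDef := PosDef.one.add_posSemidef (hpsd.smul ht.le)
  have hdet : (1 + t • vecMulVec v v).det = 1 + t * (v ⬝ᵥ v) := by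
    rw [← smul_vecMulVec, vecMulVec_eq Unit, det_one_add_replicateCol_mul_replicateRow]
    simp
  -- The Sherman–Morrison formula.
  have hinv : (1 + t • vecMulVec v v)⁻¹ = 1 - (t / (1 + t * (v ⬝ᵥ v))) • vecMulVec v v := by
    refine inv_eq_right_inv ?_
    have hs : vecMulVec v v * vecMulVec v v = (v ⬝ᵥ v) • vecMulVec v v := by
      rw [vecMulVec_mul_vecMulVec, vecMulVec_smul]
    rw [add_mul, mul_sub, mul_sub, one_mul, one_mul, mul_one, smul_mul_assoc, mul_smul_comm, hs,
      smul_smul, smul_smul]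
    have : t - t / (1 + t * (v ⬝ᵥ v)) - t * (t / (1 + t * (v ⬝ᵥ v)) * (v ⬝ᵥ v)) = 0 := by
      field_simp; ring
    have h2 : (t - t / (1 + t * (v ⬝ᵥ v)) - t * (t / (1 + t * (v ⬝ᵥ v)) * (v ⬝ᵥ v))) •
      vecMulVec v v = 0 := by rw [this, zero_smul]
    rw [sub_smul, sub_smul] at h2
    refine Eq.trans ?_ (add_zero (1 : Matrix (Fin n) (Fin n) ℝ))
    rw [← h2]
    simp only [mul_assoc]
    abel
  refine ⟨_, hA, ?_⟩
  rw [boundFunctional, hdet, hinv, add_mul, sub_mul, trace_add, trace_sub, one_mul, one_mul,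
    smul_mul_assoc, smul_mul_assoc, trace_smul, trace_smul, htr, htr, hQv, smul_zero, add_zero]
  have h3 : 0 ≤ (t / (1 + t * (v ⬝ᵥ v))) • (v ⬝ᵥ Δ *ᵥ v) := by
    rw [smul_eq_mul]; positivity
  have h4 : x ≤ Real.log (1 + t * (v ⬝ᵥ v)) := by
    rw [Real.le_log_iff_exp_le h1t, htv]
    linarith [Real.exp_le_exp.mpr (le_abs_self x)]
  have h5 : x = Q.trace + Δ.trace - n - 2 * c + 1 := rfl
  linarith

/-! ### Minimality of critical matrices -/

lemma partitionFn_mono {n N : ℕ} {Q R : Matrix (Fin n) (Fin n) ℝ} {ε r : ℝ}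
    (h : ∀ j k, |R j k - Q j k| + r ≤ ε) (w : Fin N → Fin n → ℝ) :
    partitionFn N R r w ≤ partitionFn N Q ε w := by
  refine lintegral_mono_set fun σ hσ => ⟨hσ.1, fun j k => ?_⟩
  have h1 := hσ.2 j k
  have h2 := h j k
  have h3 := neg_abs_le (R j k - Q j k)
  have h4 := le_abs_self (R j k - Q j k)
  constructor <;> linarith [h1.1, h1.2]

/-- The proof is probabilistic: for large N some field satisfies both the lower bound at the
critical `A` and the upper bound at `A'`, because the two exceptional sets have total probability
below 1. No convexity in `A` is used. -/
lemma boundFunctional_le_of_critical {n : ℕ} {R Δ A A' : Matrix (Fin n) (Fin n) ℝ}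
    (hR1 : ∀ j, R j j = 1) (hΔ : Δ.PosSemidef) (hA : A.PosDef) (hcrit : A * R * A = A + Δ)
    (hA' : A'.PosDef) : boundFunctional R Δ A ≤ boundFunctional R Δ A' := by
  refine le_of_forall_pos_le_add fun η hη => ?_
  obtain ⟨κ, hκ, hup⟩ := eventually_partitionFn_le (Δ := Δ) hR1 hA' (half_pos hη)
  have t1 := tendsto_fieldLaw_gram hΔ hκ
  have t2 := tendsto_fieldLaw_partitionFn_lt hR1 hΔ hA hcrit hκ (half_pos hη)
  have t3 := t1.add t2
  rw [add_zero] at t3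
  obtain ⟨N, h3, hup, hN⟩ := ((t3.eventually_lt_const (u := 1) (by simp)).and
    (hup.and (eventually_gt_atTop 0))).exists
  have hN' : (0 : ℝ) < N := by exact_mod_cast hN
  obtain ⟨z, hz1, hz2⟩ : ∃ z : Fin N → EuclideanSpace ℝ (Fin n),
      EntryNear (gram (fieldArray z)) Δ κ ∧
      ENNReal.ofReal (Real.exp (N * (boundFunctional R Δ A - η / 2))) ≤
        partitionFn N R κ (fieldArray z) := by
    by_contra hcon
    push Not at hcon
    refine absurd h3 (not_lt.mpr ?_)
    rw [← measure_univ (μ := fieldLaw N Δ)]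
    refine (measure_mono fun z _ => ?_).trans (measure_union_le _ _)
    by_cases hz : EntryNear (gram (fieldArray z)) Δ κ
    · exact Or.inr (hcon z hz)
    · exact Or.inl hz
  have h4 := hz2.trans (hup _ hz1)
  rw [ENNReal.ofReal_le_ofReal_iff (Real.exp_pos _).le, Real.exp_le_exp,
    mul_le_mul_iff_right₀ hN'] at h4
  linarith

/-! ### The limiting free energy -/

/-- The values `inf_A` of the bound functional at the positive definite overlap matrices in the
interior of the box of half-width `ε` around `Q`. -/
def criticalValues {n : ℕ} (Q Δ : Matrix (Fin n) (Fin n) ℝ) (ε : ℝ) : Set ℝ :=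
  {b | ∃ R A : Matrix (Fin n) (Fin n) ℝ, R.PosDef ∧ (∀ j, R j j = 1) ∧
    (∃ r > 0, ∀ j k, |R j k - Q j k| + r ≤ ε) ∧ A.PosDef ∧ A * R * A = A + Δ ∧
    b = boundFunctional R Δ A}

/-- The limit of the free energy for overlaps constrained to a box of half-width `ε`. -/
def limitFreeEnergy {n : ℕ} (Q Δ : Matrix (Fin n) (Fin n) ℝ) (ε : ℝ) : ℝ :=
  sSup (criticalValues Q Δ ε)

section Limit

variable {n : ℕ} {Q Δ : Matrix (Fin n) (Fin n) ℝ}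

lemma boundFunctional_le_add {R A : Matrix (Fin n) (Fin n) ℝ} {ε : ℝ}
    (h : EntryNear R Q ε) :
    boundFunctional R Δ A ≤ boundFunctional Q Δ A + entrySum A * ε / 2 := by
  have := (abs_le.mp (abs_trace_mul_sub_le A h)).2
  simp only [boundFunctional]
  linarith

lemma criticalValues_le (hΔ : Δ.PosSemidef) {ε : ℝ} {A : Matrix (Fin n) (Fin n) ℝ}
    (hA : A.PosDef) : ∀ b ∈ criticalValues Q Δ ε, b ≤ boundFunctional Q Δ A + entrySum A * ε / 2 := by
  rintro _ ⟨R, A', hR, hR1, ⟨r, hr, hRQ⟩, hA', hcrit, rfl⟩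
  refine (boundFunctional_le_of_critical hR1 hΔ hA' hcrit hA).trans
    (boundFunctional_le_add fun j k => ?_)
  linarith [hRQ j k]

lemma bddAbove_criticalValues (hΔ : Δ.PosSemidef) (ε : ℝ) : BddAbove (criticalValues Q Δ ε) :=
  ⟨_, fun _ hb => criticalValues_le hΔ PosDef.one _ hb⟩

/-- Mix `Q` with a small multiple of the identity: this keeps the unit diagonal, gives positive
definiteness, and moves the entries by at most ε/2. -/
lemma exists_interior_posDef (hQ : Q.PosSemidef) (hQ1 : ∀ j, Q j j = 1) {ε : ℝ} (hε : 0 < ε) :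
    ∃ R : Matrix (Fin n) (Fin n) ℝ, R.PosDef ∧ (∀ j, R j j = 1) ∧
      ∃ r > 0, ∀ j k, |R j k - Q j k| + r ≤ ε := by
  have hS := entrySum_nonneg (1 - Q)
  set s := min 1 (ε / (2 * (entrySum (1 - Q) + 1)))
  have hs0 : 0 < s := by positivity
  have hs1 : s ≤ 1 := min_le_left _ _
  have hs2 : s * entrySum (1 - Q) ≤ ε / 2 := by
    have : s ≤ ε / (2 * (entrySum (1 - Q) + 1)) := min_le_right _ _
    rw [le_div_iff₀ (by positivity)] at this
    nlinarith
  refine ⟨s • 1 + (1 - s) • Q, (PosDef.one.smul hs0).add_posSemidef (hQ.smul (by linarith)),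
    fun j => by simp [hQ1], ε / 2, half_pos hε, fun j k => ?_⟩
  have e : (s • (1 : Matrix (Fin n) (Fin n) ℝ) + (1 - s) • Q) j k - Q j k =
      s * (1 - Q) j k := by
    simp [Matrix.sub_apply]; ring
  have h1 : |(1 - Q) j k| ≤ entrySum (1 - Q) :=
    (Finset.single_le_sum (f := fun k => |(1 - Q) j k|) (fun _ _ => abs_nonneg _)
      (Finset.mem_univ k)).trans
      (Finset.single_le_sum (f := fun j => ∑ k, |(1 - Q) j k|)
        (fun _ _ => Finset.sum_nonneg fun _ _ => abs_nonneg _) (Finset.mem_univ j))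
  rw [e, abs_mul, abs_of_pos hs0]
  have := mul_le_mul_of_nonneg_left h1 hs0.le
  linarith

lemma criticalValues_nonempty (hQ : Q.PosSemidef) (hQ1 : ∀ j, Q j j = 1) (hΔ : Δ.PosSemidef)
    {ε : ℝ} (hε : 0 < ε) : (criticalValues Q Δ ε).Nonempty := by
  obtain ⟨R, hR, hR1, hRQ⟩ := exists_interior_posDef hQ hQ1 hε
  obtain ⟨A, hA, hcrit⟩ := exists_critical hR hΔ
  exact ⟨_, R, A, hR, hR1, hRQ, hA, hcrit, rfl⟩

lemma limitFreeEnergy_le (hQ : Q.PosSemidef) (hQ1 : ∀ j, Q j j = 1) (hΔ : Δ.PosSemidef)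
    {ε : ℝ} (hε : 0 < ε) {A : Matrix (Fin n) (Fin n) ℝ} (hA : A.PosDef) :
    limitFreeEnergy Q Δ ε ≤ boundFunctional Q Δ A + entrySum A * ε / 2 :=
  csSup_le (criticalValues_nonempty hQ hQ1 hΔ hε) (criticalValues_le hΔ hA)

lemma le_limitFreeEnergy (hQ : Q.PosDef) (hQ1 : ∀ j, Q j j = 1) (hΔ : Δ.PosSemidef)
    {A : Matrix (Fin n) (Fin n) ℝ} (hA : A.PosDef) (hcrit : A * Q * A = A + Δ) {ε : ℝ}
    (hε : 0 < ε) : boundFunctional Q Δ A ≤ limitFreeEnergy Q Δ ε :=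
  le_csSup (bddAbove_criticalValues hΔ ε)
    ⟨Q, A, hQ, hQ1, ⟨ε, hε, fun j k => by simp⟩, hA, hcrit, rfl⟩

/-- Here `R` may lie on the boundary of the box, whereas `criticalValues` only sees its interior.
Move `R` slightly towards an interior matrix `R₀`: the functional is affine in the overlap matrix,
so minimality at both endpoints makes the minimal value concave along the segment, and t → 0 gives
the claim. -/
lemma boundFunctional_le_limitFreeEnergy (hQ : Q.PosSemidef) (hQ1 : ∀ j, Q j j = 1)
    (hΔ : Δ.PosSemidef) {ε : ℝ} (hε : 0 < ε) {R A : Matrix (Fin n) (Fin n) ℝ} (hR : R.PosDef)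
    (hR1 : ∀ j, R j j = 1) (hRQ : ∀ j k, |R j k - Q j k| ≤ ε) (hA : A.PosDef)
    (hcrit : A * R * A = A + Δ) : boundFunctional R Δ A ≤ limitFreeEnergy Q Δ ε := by
  obtain ⟨R₀, hR₀, hR₀1, r, hr, hR₀Q⟩ := exists_interior_posDef hQ hQ1 hε
  obtain ⟨A₀, hA₀, hcrit₀⟩ := exists_critical hR₀ hΔ
  have key : ∀ t : ℝ, 0 < t → t < 1 → (1 - t) * boundFunctional R Δ A + t * boundFunctional R₀ Δ A₀ ≤
      limitFreeEnergy Q Δ ε := by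
    intro t ht0 ht1
    have hRt : ((1 - t) • R + t • R₀).PosDef := (hR.smul (by linarith)).add (hR₀.smul ht0)
    have hRt1 (j) : ((1 - t) • R + t • R₀) j j = 1 := by simp [hR1, hR₀1]
    obtain ⟨At, hAt, hcritt⟩ := exists_critical hRt hΔ
    have h1 := boundFunctional_le_of_critical hR1 hΔ hA hcrit hAt
    have h2 := boundFunctional_le_of_critical hR₀1 hΔ hA₀ hcrit₀ hAt
    have h3 : boundFunctional ((1 - t) • R + t • R₀) Δ At =
        (1 - t) * boundFunctional R Δ At + t * boundFunctional R₀ Δ At := by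
      simp only [boundFunctional, mul_add, trace_add, mul_smul_comm, trace_smul, smul_eq_mul]
      ring
    have h4 : boundFunctional ((1 - t) • R + t • R₀) Δ At ≤ limitFreeEnergy Q Δ ε := by
      refine le_csSup (bddAbove_criticalValues hΔ ε)
        ⟨_, At, hRt, hRt1, ⟨t * r, by positivity, fun j k => ?_⟩, hAt, hcritt, rfl⟩
      have e : ((1 - t) • R + t • R₀) j k - Q j k =
          (1 - t) * (R j k - Q j k) + t * (R₀ j k - Q j k) := by
        simp; ring
      rw [e]
      have h5 := abs_add_le ((1 - t) * (R j k - Q j k)) (t * (R₀ j k - Q j k))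
      rw [abs_mul, abs_mul, abs_of_pos ht0, abs_of_pos (sub_pos.mpr ht1)] at h5
      have h6 := mul_le_mul_of_nonneg_left (hRQ j k) (sub_pos.mpr ht1).le
      have h7 := mul_le_mul_of_nonneg_left (hR₀Q j k) ht0.le
      linarith
    have h5 := mul_le_mul_of_nonneg_left h1 (sub_pos.mpr ht1).le
    have h6 := mul_le_mul_of_nonneg_left h2 ht0.le
    linarith
  have hc : Tendsto (fun t : ℝ => (1 - t) * boundFunctional R Δ A + t * boundFunctional R₀ Δ A₀)
      (𝓝[>] 0) (𝓝 (boundFunctional R Δ A)) := by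
    have : Continuous fun t : ℝ =>
        (1 - t) * boundFunctional R Δ A + t * boundFunctional R₀ Δ A₀ := by fun_prop
    have h := this.tendsto 0
    simp only [sub_zero, one_mul, zero_mul, add_zero] at h
    exact h.mono_left nhdsWithin_le_nhds
  refine le_of_tendsto hc ?_
  filter_upwards [Ioo_mem_nhdsGT (show (0 : ℝ) < 1 by norm_num)] with t ht
  exact key t ht.1 ht.2

/-! ### Convergence in probability -/

lemma tendsto_partitionFn_lt (hQ : Q.PosSemidef) (hQ1 : ∀ j, Q j j = 1) (hΔ : Δ.PosSemidef)
    {ε η : ℝ} (hε : 0 < ε) (hη : 0 < η) :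
    Tendsto (fun N : ℕ => fieldLaw N Δ {z | partitionFn N Q ε (fieldArray z) <
      ENNReal.ofReal (Real.exp (N * (limitFreeEnergy Q Δ ε - η)))}) atTop (𝓝 0) := by
  obtain ⟨_, ⟨R, A, hR, hR1, ⟨r, hr, hRQ⟩, hA, hcrit, rfl⟩, hb⟩ :=
    exists_lt_of_lt_csSup (criticalValues_nonempty hQ hQ1 hΔ hε)
      (sub_lt_self (limitFreeEnergy Q Δ ε) (half_pos hη))
  have h := tendsto_fieldLaw_partitionFn_lt hR1 hΔ hA hcrit hr (half_pos hη)
  refine tendsto_of_tendsto_of_tendsto_of_le_of_le tendsto_const_nhds h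
    (fun _ => zero_le) fun N => measure_mono fun z hz => ?_
  rw [Set.mem_ofPred_eq] at hz ⊢
  exact ((partitionFn_mono hRQ _).trans_lt hz).trans_le (ENNReal.ofReal_le_ofReal
    (Real.exp_le_exp.mpr (mul_le_mul_of_nonneg_left (by linarith) (Nat.cast_nonneg _))))

/-- The positive semidefinite matrices with unit diagonal in the box of half-width `ε` around
`Q`. -/
def overlapBox (Q : Matrix (Fin n) (Fin n) ℝ) (ε : ℝ) : Set (Matrix (Fin n) (Fin n) ℝ) :=
  {R | R.PosSemidef ∧ (∀ j, R j j = 1) ∧ ∀ j k, |R j k - Q j k| ≤ ε}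

lemma isCompact_overlapBox (Q : Matrix (Fin n) (Fin n) ℝ) (ε : ℝ) : IsCompact (overlapBox Q ε) := by
  have hc : IsCompact (Set.univ.pi fun j => Set.univ.pi fun k =>
      Set.Icc (Q j k - ε) (Q j k + ε) : Set (Fin n → Fin n → ℝ)) :=
    isCompact_univ_pi fun j => isCompact_univ_pi fun k => isCompact_Icc
  have hentry (j k : Fin n) : Continuous fun R : Matrix (Fin n) (Fin n) ℝ => R j k := by fun_prop
  refine hc.of_isClosed_subset ?_ fun R hR j _ k _ => ?_
  · have h1 : IsClosed {R : Matrix (Fin n) (Fin n) ℝ | R.PosSemidef} := by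
      simp only [posSemidef_iff_dotProduct_mulVec, Set.ofPred_and, Set.ofPred_forall]
      refine IsClosed.inter ?_ (isClosed_iInter fun x => ?_)
      · exact isClosed_eq (by fun_prop) continuous_id
      · exact isClosed_le continuous_const (by fun_prop)
    have h2 : IsClosed {R : Matrix (Fin n) (Fin n) ℝ | ∀ j, R j j = 1} := by
      simp only [Set.ofPred_forall]
      exact isClosed_iInter fun j => isClosed_eq (hentry j j) continuous_const
    have h3 : IsClosed {R : Matrix (Fin n) (Fin n) ℝ | ∀ j k, |R j k - Q j k| ≤ ε} := by
      simp only [Set.ofPred_forall]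
      exact isClosed_iInter fun j => isClosed_iInter fun k =>
        isClosed_le ((hentry j k).sub continuous_const).abs continuous_const
    exact h1.inter (h2.inter h3)
  · have := abs_le.mp (hR.2.2 j k)
    constructor <;> linarith [this.1, this.2]

lemma overlap_mem_overlapBox {N : ℕ} (hN : 0 < N) {ε : ℝ}
    {σ : Fin n → EuclideanSpace ℝ (Fin N)} (hσ : σ ∈ overlapSet N Q ε) :
    (Matrix.of fun j k => overlap (σ j) (σ k)) ∈ overlapBox Q ε := by
  have hN' : (0 : ℝ) < N := by exact_mod_cast hN
  refine ⟨?_, fun j => ?_, fun j k => ?_⟩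
  · have e : (Matrix.of fun j k => overlap (σ j) (σ k)) = (1 / (N : ℝ)) • Matrix.gram ℝ σ := by
      ext j k
      simp [overlap, Matrix.gram, div_eq_inv_mul]
    rw [e]
    exact (posSemidef_gram ℝ σ).smul (by positivity)
  · have h := hσ.1 j
    rw [mem_sphere_zero_iff_norm] at h
    simp only [of_apply, overlap, real_inner_self_eq_norm_sq, h, Real.sq_sqrt hN'.le]
    field_simp
  · have h := hσ.2 j k
    rw [of_apply, abs_le]
    constructor <;> linarith [h.1, h.2]

/-- Each matrix of the compact `overlapBox` has a neighbourhood on which the local upper bound is at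
most exp N(s + η/2); finitely many of these cover all overlaps. The exceptional fields are those
whose Gram matrix is not close enough to `Δ` for one of the chosen centres. -/
lemma tendsto_lt_partitionFn (hQ : Q.PosSemidef) (hQ1 : ∀ j, Q j j = 1) (hΔ : Δ.PosSemidef)
    {ε η : ℝ} (hε : 0 < ε) (hη : 0 < η) :
    Tendsto (fun N : ℕ => fieldLaw N Δ {z | ENNReal.ofReal (Real.exp
      (N * (limitFreeEnergy Q Δ ε + η))) < partitionFn N Q ε (fieldArray z)}) atTop (𝓝 0) := by
  set s := limitFreeEnergy Q Δ ε
  have hloc : ∀ R ∈ overlapBox Q ε, ∃ κ > 0, ∀ᶠ N : ℕ in atTop, ∀ z : Fin N → Fin n → ℝ,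
      EntryNear (gram z) Δ κ →
        partitionFn N R κ z ≤ ENNReal.ofReal (Real.exp (N * (s + η / 2))) := by
    intro R hR
    obtain ⟨A, hA, hle⟩ : ∃ A : Matrix (Fin n) (Fin n) ℝ, A.PosDef ∧ boundFunctional R Δ A ≤ s := by
      by_cases hpd : R.PosDef
      · obtain ⟨A, hA, hcrit⟩ := exists_critical hpd hΔ
        exact ⟨A, hA,
          boundFunctional_le_limitFreeEnergy hQ hQ1 hΔ hε hpd hR.2.1 hR.2.2 hA hcrit⟩
      · obtain ⟨A, hA, h⟩ := exists_boundFunctional_lt_of_not_posDef hR.1 hpd hΔ s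
        exact ⟨A, hA, h.le⟩
    obtain ⟨κ, hκ, h⟩ := eventually_partitionFn_le (Δ := Δ) hR.2.1 hA (half_pos hη)
    refine ⟨κ, hκ, h.mono fun N hN z hz => (hN z hz).trans ?_⟩
    gcongr
  choose! κ hκ hloc using hloc
  have hnhds : ∀ R ∈ overlapBox Q ε, {M : Matrix (Fin n) (Fin n) ℝ | EntryNear M R (κ R)} ∈ 𝓝 R := by
    intro R hR
    have ho : IsOpen {M : Matrix (Fin n) (Fin n) ℝ | EntryNear M R (κ R)} := by
      simp only [EntryNear, Set.ofPred_forall]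
      refine isOpen_iInter_of_finite fun j => isOpen_iInter_of_finite fun k =>
        isOpen_lt (by fun_prop) continuous_const
    exact ho.mem_nhds fun j k => by simpa using hκ R hR
  obtain ⟨t, htK, htcov⟩ := (isCompact_overlapBox Q ε).elim_nhds_subcover _ hnhds
  have hlim : Tendsto (fun N : ℕ => ∑ R ∈ t,
      fieldLaw N Δ {z | ¬ EntryNear (gram (fieldArray z)) Δ (κ R)}) atTop (𝓝 0) := by
    have := tendsto_finsetSum t fun R hR => tendsto_fieldLaw_gram hΔ (hκ R (htK R hR))
    simpa using this
  refine tendsto_of_tendsto_of_tendsto_of_le_of_le' tendsto_const_nhds hlim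
    (Eventually.of_forall fun _ => zero_le) ?_
  have hev : ∀ᶠ N : ℕ in atTop, ∀ R ∈ t, ∀ z : Fin N → Fin n → ℝ, EntryNear (gram z) Δ (κ R) →
      partitionFn N R (κ R) z ≤ ENNReal.ofReal (Real.exp (N * (s + η / 2))) :=
    (Filter.eventually_all_finset t).mpr fun R hR => hloc R (htK R hR)
  -- The number of boxes does not depend on N, so it costs less than exp(Nη/2).
  have hcard : ∀ᶠ N : ℕ in atTop, (t.card : ℝ) ≤ Real.exp (N * (η / 2)) :=
    (Real.tendsto_exp_atTop.comp (tendsto_natCast_atTop_atTop.atTop_mul_const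
      (half_pos hη))).eventually_ge_atTop _
  filter_upwards [hev, hcard, eventually_gt_atTop 0] with N hev hcard hN
  have hsub : {z | ENNReal.ofReal (Real.exp (N * (s + η))) < partitionFn N Q ε (fieldArray z)} ⊆
      ⋃ R ∈ t, {z | ¬ EntryNear (gram (fieldArray z)) Δ (κ R)} := by
    intro z hz
    by_contra hcon
    simp only [Set.mem_iUnion, Set.mem_ofPred_eq, not_exists, not_not] at hcon
    rw [Set.mem_ofPred_eq] at hz
    refine absurd hz (not_lt.mpr ?_)
    have hcov : overlapSet N Q ε ⊆ ⋃ R ∈ t, overlapSet N R (κ R) := by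
      intro σ hσ
      have h := htcov (overlap_mem_overlapBox hN hσ)
      simp only [Set.mem_iUnion, Set.mem_ofPred_eq] at h ⊢
      obtain ⟨R, hR, h⟩ := h
      refine ⟨R, hR, hσ.1, fun j k => ?_⟩
      have := abs_lt.mp (h j k)
      rw [of_apply] at this
      constructor <;> linarith [this.1, this.2]
    calc partitionFn N Q ε (fieldArray z) ≤ ∑ R ∈ t, partitionFn N R (κ R) (fieldArray z) := by
          refine (lintegral_mono_set hcov).trans ?_
          rw [show (⋃ R ∈ t, overlapSet N R (κ R)) = ⋃ R : t, overlapSet N R.1 (κ R.1) from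
            Set.biUnion_eq_iUnion (t : Set _) fun R _ => overlapSet N R (κ R)]
          refine (lintegral_iUnion_le _ _).trans (le_of_eq ?_)
          rw [tsum_fintype]
          exact Finset.sum_coe_sort t fun R => partitionFn N R (κ R) (fieldArray z)
      _ ≤ ∑ R ∈ t, ENNReal.ofReal (Real.exp (N * (s + η / 2))) :=
          Finset.sum_le_sum fun R hR => hev R hR _ (hcon R hR)
      _ = ENNReal.ofReal (t.card * Real.exp (N * (s + η / 2))) := by
          rw [Finset.sum_const, nsmul_eq_mul, ENNReal.ofReal_mul (by positivity),
            ENNReal.ofReal_natCast]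
      _ ≤ ENNReal.ofReal (Real.exp (N * (η / 2)) * Real.exp (N * (s + η / 2))) := by gcongr
      _ = _ := by
          rw [← Real.exp_add]; congr 2; ring
  exact (measure_mono hsub).trans (measure_biUnion_finset_le _ _)

end Limit

/-! ### Convergence of the expectations -/

/-- Convergence in probability plus uniform integrability, on probability spaces that vary with N.
The quadratic majorant `q` of `a`, with bounded means, supplies the uniform integrability. -/
lemma tendsto_integral_of_tendsto_measure {Ω : ℕ → Type*} [∀ N, MeasurableSpace (Ω N)]
    (P : ∀ N, Measure (Ω N)) [∀ N, IsProbabilityMeasure (P N)] {f a q : ∀ N, Ω N → ℝ}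
    {s C C' : ℝ} (hC : 0 ≤ C)
    (hf : ∀ᶠ N in atTop, Measurable (f N)) (hq : ∀ᶠ N in atTop, Integrable (q N) (P N))
    (hq' : ∀ᶠ N in atTop, ∫ x, q N x ∂P N ≤ C')
    (haq : ∀ᶠ N in atTop, ∀ x, a N x ^ 2 ≤ q N x)
    (hfa : ∀ᶠ N in atTop, ∀ x, |f N x - s| ≤ C + a N x)
    (hprob : ∀ η > 0, Tendsto (fun N => P N {x | η < |f N x - s|}) atTop (𝓝 0)) :
    (∀ᶠ N in atTop, Integrable (f N) (P N)) ∧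
      Tendsto (fun N => ∫ x, f N x ∂P N) atTop (𝓝 s) := by
  have hint : ∀ᶠ N in atTop, Integrable (f N) (P N) := by
    filter_upwards [hf, hq, haq, hfa] with N hf hq haq hfa
    have hdom : Integrable (fun x => C + 1 + |s| + q N x) (P N) := (integrable_const _).add hq
    refine hdom.mono' hf.aestronglyMeasurable (Eventually.of_forall fun x => ?_)
    have h1 := haq x
    have h2 := hfa x
    have h3 := abs_sub_abs_le_abs_sub (f N x) s
    rw [Real.norm_eq_abs]
    nlinarith [sq_nonneg (a N x - 1)]
  refine ⟨hint, ?_⟩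
  rw [Metric.tendsto_nhds]
  intro δ hδ
  have hC'1 : 0 < |C'| + 1 := by positivity
  -- On the bad event a ≤ 1/(4θ) + θa², so |f − s| ≤ D + θq there. The three terms δ/4, P(bad)·D and
  -- θ∫q are each at most δ/4.
  set θ := δ / (4 * (|C'| + 1)) with hθ
  have hθ0 : 0 < θ := by positivity
  set D := C + 1 / (4 * θ)
  have hD : 0 ≤ D := by positivity
  have hp := (ENNReal.tendsto_toReal ENNReal.zero_ne_top).comp (hprob (δ / 4) (by positivity))
  have hp' : ∀ᶠ N in atTop, (P N).real {x | δ / 4 < |f N x - s|} * D < δ / 4 := by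
    have : Tendsto (fun N => (P N).real {x | δ / 4 < |f N x - s|} * D) atTop (𝓝 (0 * D)) :=
      hp.mul_const D
    rw [zero_mul] at this
    exact this.eventually_lt_const (by positivity)
  filter_upwards [hf, hq, hq', haq, hfa, hint, hp'] with N hf hq hq' haq hfa hint hp'
  set bad := {x | δ / 4 < |f N x - s|} with hbad
  have hbadm : MeasurableSet bad := measurableSet_lt measurable_const (hf.sub_const s).abs
  have hind : Integrable (bad.indicator fun _ => D) (P N) := (integrable_const D).indicator hbadm
  have hdom : Integrable (fun x => δ / 4 + bad.indicator (fun _ => D) x + θ * q N x) (P N) :=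
    ((integrable_const _).add hind).add (hq.const_mul θ)
  have hpt (x) : |f N x - s| ≤ δ / 4 + bad.indicator (fun _ => D) x + θ * q N x := by
    have h1 := haq x
    have hqx : 0 ≤ q N x := (sq_nonneg _).trans h1
    by_cases hx : x ∈ bad
    · rw [Set.indicator_of_mem hx]
      have h2 := hfa x
      have h3 : a N x ≤ 1 / (4 * θ) + θ * a N x ^ 2 := by
        have h5 := sq_nonneg (2 * θ * a N x - 1)
        have h6 : 1 / (4 * θ) + θ * a N x ^ 2 - a N x = (2 * θ * a N x - 1) ^ 2 / (4 * θ) := by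
          field_simp; ring
        have : 0 ≤ (2 * θ * a N x - 1) ^ 2 / (4 * θ) := by positivity
        linarith
      have h4 := mul_le_mul_of_nonneg_left h1 hθ0.le
      have h7 : D = C + 1 / (4 * θ) := rfl
      linarith
    · rw [Set.indicator_of_notMem hx]
      have h2 : |f N x - s| ≤ δ / 4 := not_lt.mp hx
      have : 0 ≤ θ * q N x := by positivity
      linarith
  rw [Real.dist_eq]
  have e : ∫ x, f N x ∂P N - s = ∫ x, (f N x - s) ∂P N := by
    rw [integral_sub hint (integrable_const _)]; simp
  rw [e]
  refine lt_of_le_of_lt (abs_integral_le_integral_abs.trans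
    (integral_mono (hint.sub (integrable_const _)).abs hdom hpt)) ?_
  have hi1 : Integrable (fun x => δ / 4 + bad.indicator (fun _ => D) x) (P N) :=
    (integrable_const _).add hind
  rw [integral_add hi1 (hq.const_mul θ), integral_add (integrable_const _) hind,
    integral_const_mul, integral_indicator hbadm]
  simp only [integral_const, probReal_univ, smul_eq_mul, one_mul,
    measureReal_restrict_apply_univ]
  have h1 : θ * ∫ x, q N x ∂P N ≤ θ * (|C'| + 1) := by
    gcongr
    linarith [le_abs_self C']
  have h2 : θ * (|C'| + 1) = δ / 4 := by rw [hθ]; field_simp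
  linarith

/-! ### The free energy -/

section FreeEnergy

variable {n : ℕ} {Q Δ : Matrix (Fin n) (Fin n) ℝ}

lemma logPartition_eq_log_partitionFn (N : ℕ) (ε : ℝ) (z : Fin N → EuclideanSpace ℝ (Fin n)) :
    logPartition N Q ε z = Real.log (partitionFn N Q ε (fieldArray z)).toReal := by
  rw [logPartition, integral_eq_lintegral_of_nonneg_ae
    (Eventually.of_forall fun _ => (Real.exp_pos _).le)
    (Continuous.aestronglyMeasurable (by fun_prop))]
  rfl

lemma isProbabilityMeasure_productUniform {N : ℕ} (hN : 0 < N) :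
    IsProbabilityMeasure (productUniform n N) := by
  have := isProbabilityMeasure_sphereUniform hN
  unfold productUniform
  infer_instance

lemma measurable_logPartition {N : ℕ} (hN : 0 < N) (ε : ℝ) :
    Measurable (logPartition N Q ε) := by
  have := isProbabilityMeasure_productUniform (n := n) hN
  have h : Measurable fun z : Fin N → EuclideanSpace ℝ (Fin n) =>
      partitionFn N Q ε (fieldArray z) := by
    refine Measurable.lintegral_prod_right'
      (f := fun p : (Fin N → EuclideanSpace ℝ (Fin n)) × (Fin n → EuclideanSpace ℝ (Fin N)) =>
        ENNReal.ofReal (Real.exp (∑ j, inner ℝ (p.2 j) (column (fieldArray p.1) j)))) ?_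
    unfold column fieldArray
    exact (Continuous.measurable (by fun_prop)).ennreal_ofReal
  simp only [funext (logPartition_eq_log_partitionFn (Q := Q) N ε)]
  exact Real.measurable_log.comp h.ennreal_toReal

/-- The sum of the normalized norms of the columns of an array. -/
def normSum {N : ℕ} (w : Fin N → Fin n → ℝ) : ℝ := ∑ j, ‖column w j‖ / √N

lemma abs_sum_inner_le {N : ℕ} (hN : 0 < N) {ε : ℝ} {σ : Fin n → EuclideanSpace ℝ (Fin N)}
    (hσ : σ ∈ overlapSet N Q ε) (w : Fin N → Fin n → ℝ) :
    |∑ j, inner ℝ (σ j) (column w j)| ≤ N * normSum w := by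
  have hN' : (0 : ℝ) < N := by exact_mod_cast hN
  rw [normSum, Finset.mul_sum]
  refine (Finset.abs_sum_le_sum_abs _ _).trans (Finset.sum_le_sum fun j _ => ?_)
  refine (abs_real_inner_le_norm _ _).trans (le_of_eq ?_)
  rw [mem_sphere_zero_iff_norm.mp (hσ.1 j)]
  have : √(N : ℝ) ≠ 0 := (Real.sqrt_pos.mpr hN').ne'
  field_simp
  rw [Real.sq_sqrt hN'.le, mul_comm]

lemma partitionFn_le {N : ℕ} (hN : 0 < N) (ε : ℝ) (w : Fin N → Fin n → ℝ) :
    partitionFn N Q ε w ≤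
      ENNReal.ofReal (Real.exp (N * normSum w)) * productUniform n N (overlapSet N Q ε) := by
  rw [← setLIntegral_const]
  refine setLIntegral_mono' (isClosed_overlapSet N Q ε).measurableSet fun σ hσ => ?_
  gcongr
  exact (abs_le.mp (abs_sum_inner_le hN hσ w)).2

lemma le_partitionFn_of_norm {N : ℕ} (hN : 0 < N) (ε : ℝ) (w : Fin N → Fin n → ℝ) :
    ENNReal.ofReal (Real.exp (-(N * normSum w))) * productUniform n N (overlapSet N Q ε) ≤
      partitionFn N Q ε w := by
  rw [← setLIntegral_const]
  refine setLIntegral_mono' (isClosed_overlapSet N Q ε).measurableSet fun σ hσ => ?_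
  gcongr
  exact (abs_le.mp (abs_sum_inner_le hN hσ w)).1

/-- The volume estimate is read off from the free energy: a field of bounded normalized norm with Z
≥ exp N(s − 1) exists, while Z ≤ exp(NS) times the volume of the box. -/
lemma eventually_le_productUniform (hQ : Q.PosSemidef) (hQ1 : ∀ j, Q j j = 1)
    (hΔ : Δ.PosSemidef) {ε : ℝ} (hε : 0 < ε) : ∃ C : ℝ, ∀ᶠ N : ℕ in atTop,
      ENNReal.ofReal (Real.exp (-(N * C))) ≤ productUniform n N (overlapSet N Q ε) := by
  set s := limitFreeEnergy Q Δ ε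
  set S := ∑ j, √(|Δ j j| + 1)
  refine ⟨S - (s - 1), ?_⟩
  have t3 := (tendsto_fieldLaw_gram hΔ one_pos).add (tendsto_partitionFn_lt hQ hQ1 hΔ hε one_pos)
  rw [add_zero] at t3
  filter_upwards [t3.eventually_lt_const (u := 1) (by simp), eventually_gt_atTop 0] with N h3 hN
  have hN' : (0 : ℝ) < N := by exact_mod_cast hN
  obtain ⟨z, hz1, hz2⟩ : ∃ z : Fin N → EuclideanSpace ℝ (Fin n),
      EntryNear (gram (fieldArray z)) Δ 1 ∧
      ENNReal.ofReal (Real.exp (N * (s - 1))) ≤ partitionFn N Q ε (fieldArray z) := by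
    by_contra hcon
    push Not at hcon
    refine absurd h3 (not_lt.mpr ?_)
    rw [← measure_univ (μ := fieldLaw N Δ)]
    refine (measure_mono fun z _ => ?_).trans (measure_union_le _ _)
    by_cases hz : EntryNear (gram (fieldArray z)) Δ 1
    · exact Or.inr (hcon z hz)
    · exact Or.inl hz
  have hsum : normSum (fieldArray z) ≤ S := by
    refine Finset.sum_le_sum fun j _ => ?_
    rw [div_le_iff₀ (Real.sqrt_pos.mpr hN'), mul_comm]
    exact norm_column_le_of_entryNear hN le_rfl hz1 j
  have h4 : ENNReal.ofReal (Real.exp (N * (s - 1))) ≤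
      ENNReal.ofReal (Real.exp (N * S)) * productUniform n N (overlapSet N Q ε) := by
    refine (hz2.trans (partitionFn_le hN ε _)).trans ?_
    gcongr
  calc ENNReal.ofReal (Real.exp (-(N * (S - (s - 1)))))
      = ENNReal.ofReal (Real.exp (-(N * S))) * ENNReal.ofReal (Real.exp (N * (s - 1))) := by
        rw [← ENNReal.ofReal_mul (Real.exp_pos _).le, ← Real.exp_add]; congr 2; ring
    _ ≤ ENNReal.ofReal (Real.exp (-(N * S))) *
        (ENNReal.ofReal (Real.exp (N * S)) * productUniform n N (overlapSet N Q ε)) := by gcongr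
    _ = _ := by
        rw [← mul_assoc, ← ENNReal.ofReal_mul (Real.exp_pos _).le, ← Real.exp_add]; simp

lemma mul_le_log_toReal {x : ENNReal} (hx : x ≠ ⊤) {c : ℝ}
    (h : ENNReal.ofReal (Real.exp c) ≤ x) : c ≤ Real.log x.toReal := by
  have h1 : Real.exp c ≤ x.toReal := (ENNReal.ofReal_le_iff_le_toReal hx).mp h
  rwa [Real.le_log_iff_exp_le ((Real.exp_pos c).trans_le h1)]

lemma log_toReal_le {x : ENNReal} (hx : x ≠ 0) {c : ℝ}
    (h : x ≤ ENNReal.ofReal (Real.exp c)) : Real.log x.toReal ≤ c := by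
  have hx' : x ≠ ⊤ := ne_top_of_le_ne_top ENNReal.ofReal_ne_top h
  rw [Real.log_le_iff_le_exp (ENNReal.toReal_pos hx hx')]
  exact ENNReal.toReal_le_of_le_ofReal (Real.exp_pos c).le h

lemma integral_fieldLaw_gram {N : ℕ} (hN : 0 < N) (hΔ : Δ.PosSemidef) (j : Fin n) :
    Integrable (fun z : Fin N → EuclideanSpace ℝ (Fin n) => SphericalModel.gram (fieldArray z) j j)
      (fieldLaw N Δ) ∧
    ∫ z, SphericalModel.gram (fieldArray z) j j ∂fieldLaw N Δ = Δ j j := by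
  have hN' : (N : ℝ) ≠ 0 := by exact_mod_cast hN.ne'
  have hint0 : Integrable (fun x : EuclideanSpace ℝ (Fin n) => x j * x j)
      (multivariateGaussian 0 Δ) :=
    ((memLp_multivariateGaussian Δ j (p := 4) (by simp)).mul'
      (memLp_multivariateGaussian Δ j (p := 4) (by simp)) (r := 2)).integrable one_le_two
  have hint (i : Fin N) : Integrable (fun z : Fin N → EuclideanSpace ℝ (Fin n) => z i j * z i j)
      (fieldLaw N Δ) :=
    (measurePreserving_eval (fun _ : Fin N => multivariateGaussian 0 Δ) i).integrable_comp_of_integrable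
      hint0
  have hval (i : Fin N) : ∫ z : Fin N → EuclideanSpace ℝ (Fin n), z i j * z i j ∂fieldLaw N Δ =
      Δ j j := by
    rw [← integral_multivariateGaussian_mul hΔ j j]
    exact integral_comp_eval (μ := fun _ : Fin N => multivariateGaussian 0 Δ) (i := i)
      hint0.aestronglyMeasurable
  refine ⟨(integrable_finsetSum _ fun i _ => hint i).div_const _, ?_⟩
  simp only [SphericalModel.gram, of_apply, fieldArray]
  rw [integral_div, integral_finsetSum _ fun i _ => hint i]
  simp only [hval]
  simp
  field_simp

lemma normSum_sq_le {N : ℕ} (hN : 0 < N) (w : Fin N → Fin n → ℝ) :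
    normSum w ^ 2 ≤ n * ∑ j, SphericalModel.gram w j j := by
  have hN' : (0 : ℝ) < N := by exact_mod_cast hN
  have h := sq_sum_le_card_mul_sum_sq (s := Finset.univ) (f := fun j => ‖column w j‖ / √N)
  simp only [Finset.card_univ, Fintype.card_fin] at h
  refine h.trans (le_of_eq ?_)
  congr 1
  refine Finset.sum_congr rfl fun j _ => ?_
  rw [div_pow, norm_column_sq hN, Real.sq_sqrt hN'.le]
  field_simp

/-- The two one-sided bounds give convergence in probability. The deterministic bound |N⁻¹ log Z| ≤
|C| + `normSum`, with |C| coming from the volume estimate, gives uniform integrability, since the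
mean of `normSum`² is at most n Tr Δ. -/
theorem freeEnergy_tendsto (hQ : Q.PosSemidef) (hQ1 : ∀ j, Q j j = 1) (hΔ : Δ.PosSemidef)
    {ε : ℝ} (hε : 0 < ε) :
    (∀ᶠ N : ℕ in atTop, 0 < productUniform n N (overlapSet N Q ε) ∧
      Integrable (logPartition N Q ε) (fieldLaw N Δ)) ∧
    Tendsto (fun N : ℕ => (1 / (N : ℝ)) * ∫ z, logPartition N Q ε z ∂fieldLaw N Δ) atTop
      (𝓝 (limitFreeEnergy Q Δ ε)) := by
  set s := limitFreeEnergy Q Δ ε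
  obtain ⟨C, hC⟩ := eventually_le_productUniform hQ hQ1 hΔ hε
  have hpos : ∀ᶠ N : ℕ in atTop, 0 < productUniform n N (overlapSet N Q ε) :=
    hC.mono fun N h => (ENNReal.ofReal_pos.mpr (Real.exp_pos _)).trans_le h
  have hfin {N : ℕ} (hN : 0 < N) (w : Fin N → Fin n → ℝ) : partitionFn N Q ε w ≠ ⊤ := by
    have := isProbabilityMeasure_productUniform (n := n) hN
    exact ne_top_of_le_ne_top (ENNReal.mul_ne_top ENNReal.ofReal_ne_top (measure_ne_top _ _))
      (partitionFn_le hN ε w)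
  have hne {N : ℕ} (hN : 0 < N) (h : 0 < productUniform n N (overlapSet N Q ε))
      (w : Fin N → Fin n → ℝ) : partitionFn N Q ε w ≠ 0 :=
    ((ENNReal.mul_pos (ENNReal.ofReal_pos.mpr (Real.exp_pos _)).ne' h.ne').trans_le
      (le_partitionFn_of_norm hN ε w)).ne'
  have hprob : ∀ η > 0, Tendsto (fun N : ℕ => fieldLaw N Δ
      {z | η < |1 / (N : ℝ) * logPartition N Q ε z - s|}) atTop (𝓝 0) := by
    intro η hη
    have t := (tendsto_partitionFn_lt hQ hQ1 hΔ hε hη).add (tendsto_lt_partitionFn hQ hQ1 hΔ hε hη)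
    rw [add_zero] at t
    refine tendsto_of_tendsto_of_tendsto_of_le_of_le' tendsto_const_nhds t
      (Eventually.of_forall fun _ => zero_le) ?_
    filter_upwards [hpos, eventually_gt_atTop 0] with N hpos hN
    have hN' : (0 : ℝ) < N := by exact_mod_cast hN
    refine (measure_mono fun z hz => ?_).trans (measure_union_le _ _)
    by_contra hcon
    simp only [Set.mem_union, Set.mem_ofPred_eq, not_or, not_lt] at hcon
    rw [Set.mem_ofPred_eq] at hz
    refine absurd hz (not_lt.mpr ?_)
    have h1 := mul_le_log_toReal (hfin hN _) hcon.1
    have h2 := log_toReal_le (hne hN hpos _) hcon.2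
    rw [logPartition_eq_log_partitionFn, one_div_mul_eq_div, abs_le]
    constructor
    · rw [neg_le_sub_iff_le_add, ← sub_le_iff_le_add, le_div_iff₀ hN', mul_comm]; exact h1
    · rw [sub_le_iff_le_add', div_le_iff₀ hN', mul_comm]; exact h2
  have hmain := tendsto_integral_of_tendsto_measure (fun N => fieldLaw N Δ)
    (f := fun N z => 1 / (N : ℝ) * logPartition N Q ε z)
    (a := fun N z => normSum (fieldArray z))
    (q := fun N z => n * ∑ j, SphericalModel.gram (fieldArray z) j j) (s := s) (C := |C| + |s|)
    (C' := n * ∑ j, Δ j j) (by positivity)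
    ((eventually_gt_atTop 0).mono fun N hN => (measurable_logPartition hN ε).const_mul _)
    ((eventually_gt_atTop 0).mono fun N hN => (integrable_finsetSum _ fun j _ =>
      (integral_fieldLaw_gram hN hΔ j).1).const_mul _)
    ((eventually_gt_atTop 0).mono fun N hN => by
      rw [integral_const_mul, integral_finsetSum _ fun j _ => (integral_fieldLaw_gram hN hΔ j).1]
      simp only [(integral_fieldLaw_gram hN hΔ _).2, le_refl])
    ((eventually_gt_atTop 0).mono fun N hN z => normSum_sq_le hN _)
    (by
      filter_upwards [hC, hpos, eventually_gt_atTop 0] with N hC hpos hN z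
      have := isProbabilityMeasure_productUniform (n := n) hN
      have hN' : (0 : ℝ) < N := by exact_mod_cast hN
      have h1 : -(N * normSum (fieldArray z)) + -(N * C) ≤ logPartition N Q ε z := by
        rw [logPartition_eq_log_partitionFn]
        refine mul_le_log_toReal (hfin hN _) (le_trans ?_ (le_partitionFn_of_norm hN ε _))
        rw [Real.exp_add, ENNReal.ofReal_mul (Real.exp_pos _).le]
        gcongr
      have h2 : logPartition N Q ε z ≤ N * normSum (fieldArray z) := by
        rw [logPartition_eq_log_partitionFn]
        refine log_toReal_le (hne hN hpos _) ((partitionFn_le hN ε _).trans ?_)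
        exact mul_le_of_le_one_right zero_le prob_le_one
      have h3 : |1 / (N : ℝ) * logPartition N Q ε z| ≤ |C| + normSum (fieldArray z) := by
        rw [one_div_mul_eq_div, abs_le]
        constructor
        · rw [le_div_iff₀ hN']
          have := mul_le_mul_of_nonneg_left (le_abs_self C) hN'.le
          linarith
        · rw [div_le_iff₀ hN']
          have := mul_nonneg hN'.le (abs_nonneg C)
          linarith
      have := abs_sub (1 / (N : ℝ) * logPartition N Q ε z) s
      linarith)
    hprob
  refine ⟨?_, hmain.2.congr fun N => integral_const_mul _ _⟩
  filter_upwards [hpos, hmain.1, eventually_gt_atTop 0] with N hpos hint hN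
  refine ⟨hpos, ?_⟩
  have hN' : (N : ℝ) ≠ 0 := by exact_mod_cast hN.ne'
  have := hint.const_mul (N : ℝ)
  refine this.congr (Eventually.of_forall fun z => ?_)
  simp only
  field_simp

/-- From above, each fixed `A` bounds the limit up to a term linear in ε. From below, a positive
definite `Q` is itself admissible for every ε; for singular `Q` the infimum is −∞ and there is
nothing to prove. -/
theorem limitFreeEnergy_tendsto (hQ : Q.PosSemidef) (hQ1 : ∀ j, Q j j = 1) (hΔ : Δ.PosSemidef) :
    Tendsto (fun ε : ℝ => (limitFreeEnergy Q Δ ε : EReal)) (𝓝[>] 0)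
      (𝓝 (⨅ A : {A : Matrix (Fin n) (Fin n) ℝ // A.PosDef},
        (boundFunctional Q Δ A.1 : EReal))) := by
  have hpos : ∀ᶠ ε : ℝ in 𝓝[>] 0, 0 < ε := self_mem_nhdsWithin
  refine tendsto_order.mpr ⟨fun a ha => ?_, fun a ha => ?_⟩
  · by_cases hpd : Q.PosDef
    · obtain ⟨A, hA, hcrit⟩ := exists_critical hpd hΔ
      filter_upwards [hpos] with ε hε
      exact (ha.trans_le (iInf_le _ (⟨A, hA⟩ : {A : Matrix (Fin n) (Fin n) ℝ // A.PosDef}))).trans_le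
        (EReal.coe_le_coe_iff.mpr (le_limitFreeEnergy hpd hQ1 hΔ hA hcrit hε))
    · exfalso
      have hbot : (⨅ A : {A : Matrix (Fin n) (Fin n) ℝ // A.PosDef},
          (boundFunctional Q Δ A.1 : EReal)) = ⊥ := by
        refine iInf_eq_bot.mpr fun b hb => ?_
        obtain ⟨c, _, hc⟩ := EReal.lt_iff_exists_real_btwn.mp hb
        obtain ⟨A, hA, h⟩ := exists_boundFunctional_lt_of_not_posDef hQ hpd hΔ c
        exact ⟨⟨A, hA⟩, (EReal.coe_lt_coe_iff.mpr h).trans hc⟩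
      rw [hbot] at ha
      exact not_lt_bot ha
  · obtain ⟨⟨A, hA⟩, h⟩ := iInf_lt_iff.mp ha
    have hc : Tendsto (fun ε : ℝ => ((boundFunctional Q Δ A + entrySum A * ε / 2 : ℝ) : EReal))
        (𝓝[>] 0) (𝓝 (boundFunctional Q Δ A : EReal)) := by
      refine (continuous_coe_real_ereal.tendsto _).comp ?_
      have : Continuous fun ε : ℝ => boundFunctional Q Δ A + entrySum A * ε / 2 := by fun_prop
      have h := this.tendsto 0
      simp only [mul_zero, zero_div, add_zero] at h
      exact h.mono_left nhdsWithin_le_nhds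
    filter_upwards [hpos, hc.eventually_lt_const h] with ε hε h
    exact (EReal.coe_le_coe_iff.mpr (limitFreeEnergy_le hQ hQ1 hΔ hε hA)).trans_lt h

end FreeEnergy

end SphericalModel

end

/-- The inner limit (as `N → ∞`) exists and is finite for every `ε > 0`. The outer limit and the
infimum are taken in `[-∞, ∞]`: both equal `-∞` when `Q` is singular. -/
theorem lemma4 (n : ℕ) (Q Δ₀ : Matrix (Fin n) (Fin n) ℝ)
    (hQ : Q.PosSemidef) (hQ1 : ∀ j, Q j j = 1) (hΔ : Δ₀.PosSemidef) :
    ∃ L : ℝ → ℝ,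
      (∀ ε : ℝ, 0 < ε →
        (∀ᶠ N : ℕ in atTop,
          0 < SphericalModel.productUniform n N (SphericalModel.overlapSet N Q ε) ∧
          Integrable (SphericalModel.logPartition N Q ε) (SphericalModel.fieldLaw N Δ₀)) ∧
        Tendsto
          (fun N : ℕ => (1 / (N : ℝ)) *
            ∫ z, SphericalModel.logPartition N Q ε z ∂SphericalModel.fieldLaw N Δ₀)
          atTop (𝓝 (L ε))) ∧
      Tendsto (fun ε : ℝ => (L ε : EReal)) (𝓝[>] 0)
        (𝓝 (⨅ A : {A : Matrix (Fin n) (Fin n) ℝ // A.PosDef},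
          (SphericalModel.boundFunctional Q Δ₀ A.1 : EReal))) := by
  refine ⟨SphericalModel.limitFreeEnergy Q Δ₀, fun ε hε => ?_,
    SphericalModel.limitFreeEnergy_tendsto hQ hQ1 hΔ⟩
  exact SphericalModel.freeEnergy_tendsto hQ hQ1 hΔ hε
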